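/- Let $(U_n,V_n)_{n\ge 0}$ be simple random walk on $\mathbb{Z}^2$ started at $(0,0)$ and let $T=\inf\{n>0: V_n=0\}$. Then $T<\infty$ almost surely; the law $P_0$ of $U_T$ on $\mathbb{Z}$ is called the discrete Cauchy law. Let $P_1$ be the law with $P_1\{1\}=P_1\{-1\}=\tfrac12$, and let $\widetilde P_1$ be its lazy version, $\widetilde P_1\{1\}=\widetilde P_1\{-1\}=\tfrac14$, $\widetilde P_1\{0\}=\tfrac12$. A process $(S_n)_{n\ge0}$ on $\mathbb{Z}$ is called recurrent if almost surely it visits every $x\in\mathbb{Z}$ infinitely often; a law on $\mathbb{Z}$ is called recurrent if the random walk with i.i.d. steps of that law is recurrent. Given a countable family $(R_j)_{j\in J}$ of probability laws on $\mathbb{Z}$, a mixture of $(R_j)_{j\in J}$ is a process $(S_n,i(n))_{n\ge0}$ with values in $\mathbb{Z}\times J$ such that, for every $n\ge0$, the conditional law of $S_{n+1}-S_n$ given the $\sigma$-field $\sigma\big((S_\ell,i(\ell))_{\ell\le n},\,i(n+1)\big)$ is $R_{i(n+1)}$; the starting point and the (possibly randomized) rule for choosing $i(n+1)$ are otherwise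 arbitrary. 1. $P_0$ is recurrent. 2. For every mixture $(S_n,i(n))$ of $\widetilde P_1$ and $P_0$, the process $S$ is recurrent. 3. (Removal of laziness.) Let $(\widetilde R_j)_{j\in J}$ be a countable family of probability laws on $\mathbb{Z}$ such that $S$ is recurrent for every mixture $(S_n,i(n))$ of $(\widetilde R_j)_{j\in J}$. Let $I\subseteq J$, put $R_j=\widetilde R_j$ for $j\notin I$, and for $j\in I$ let $R_j$ be $\widetilde R_j$ conditioned on $\mathbb{Z}\setminus\{0\}$. Then $S$ is recurrent for every mixture $(S_n,i(n))$ of $(R_j)_{j\in J}$. 4. For every mixture $(S_n,i(n))$ of $P_1$ and $P_0$, the process $S$ is recurrent. 5. In particular, Benjamini's walk is recurrent, from any starting point: this is the process $(S_n)_{n\ge0}$ on $\mathbb{Z}$ such that, for every $n\ge 0$, the conditional law of $S_{n+1}-S_n$ given $S_0,\dots,S_n$ is $P_0$ if $S_n\notin\{S_0,\dots,S_{n-1}\}$ and $P_1$ otherwise. -/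

import Mathlib

open MeasureTheory ProbabilityTheory Filter
open scoped ENNReal ProbabilityTheory

universe u v

noncomputable section

/-! ### Simple random walk on `ℤ²` and the discrete Cauchy law -/

/-- The step law of simple random walk on `ℤ²`: mass `1/4` on each of the four unit vectors. -/
def srwStep : Measure (ℤ × ℤ) :=
  (4⁻¹ : ℝ≥0∞) • (Measure.dirac (1, 0) + Measure.dirac (-1, 0)
    + Measure.dirac (0, 1) + Measure.dirac (0, -1))

instance srwStep_isProbabilityMeasure : IsProbabilityMeasure srwStep := by
  constructor
  simp only [srwStep, Measure.smul_apply, Measure.add_apply, measure_univ, smul_eq_mul]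
  have h : (1 + 1 + 1 + 1 : ℝ≥0∞) = 4 := by norm_num
  rw [h]
  exact ENNReal.inv_mul_cancel (by norm_num) (by norm_num)

/-- The law of the sequence of i.i.d. steps of simple random walk on `ℤ²`. -/
def srwLaw : Measure (ℕ → ℤ × ℤ) := Measure.infinitePi (fun _ : ℕ => srwStep)

instance srwLaw_isProbabilityMeasure : IsProbabilityMeasure srwLaw := by
  unfold srwLaw; infer_instance

/-- The position `(U n, V n)` after `n` steps of the walk started at the origin. -/
def srwPos (ξ : ℕ → ℤ × ℤ) (n : ℕ) : ℤ × ℤ := ∑ l ∈ Finset.range n, ξ l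

/-- `T = inf {n > 0 : V n = 0}`, the first return time to the horizontal axis
(with the value `0` if there is no return). -/
def srwReturnTime (ξ : ℕ → ℤ × ℤ) : ℕ := sInf {n : ℕ | 0 < n ∧ (srwPos ξ n).2 = 0}

/-- The position `U T` of the first return to the horizontal axis. -/
def srwReturnPos (ξ : ℕ → ℤ × ℤ) : ℤ := (srwPos ξ (srwReturnTime ξ)).1

/-- The discrete Cauchy law: the law of `U T` for simple random walk on `ℤ²`. -/
def discreteCauchy : Measure ℤ := srwLaw.map srwReturnPos

theorem measurable_srwPos (n : ℕ) : Measurable (fun ξ => srwPos ξ n) :=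
  Finset.measurable_sum _ fun l _ => measurable_pi_apply l

theorem measurable_srwReturnTime : Measurable srwReturnTime := by
  have hset : ∀ n : ℕ, MeasurableSet {ξ : ℕ → ℤ × ℤ | 0 < n ∧ (srwPos ξ n).2 = 0} := fun n =>
    (MeasurableSet.const _).inter
      (measurable_snd.comp (measurable_srwPos n) (measurableSet_singleton (0 : ℤ)))
  refine measurable_of_Iic fun k => ?_
  have : srwReturnTime ⁻¹' Set.Iic k =
      (⋃ n ∈ Set.Iic k, {ξ | 0 < n ∧ (srwPos ξ n).2 = 0}) ∪
        (⋂ n, {ξ | 0 < n ∧ (srwPos ξ n).2 = 0}ᶜ) := by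
    ext ξ
    simp only [Set.mem_preimage, Set.mem_Iic, Set.mem_union, Set.mem_iUnion, Set.mem_iInter,
      Set.mem_compl_iff, Set.mem_ofPred_eq, exists_prop, srwReturnTime]
    constructor
    · intro h
      by_cases hne : {n : ℕ | 0 < n ∧ (srwPos ξ n).2 = 0}.Nonempty
      · exact Or.inl ⟨_, h, Nat.sInf_mem hne⟩
      · refine Or.inr fun n hn => hne ⟨n, hn⟩
    · rintro (⟨n, hn, h⟩ | h)
      · exact (Nat.sInf_le h).trans hn
      · have : {n : ℕ | 0 < n ∧ (srwPos ξ n).2 = 0} = ∅ := Set.eq_empty_of_forall_notMem h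
        simp [this]
  rw [this]
  exact (MeasurableSet.biUnion (Set.to_countable _) fun n _ => hset n).union
    (MeasurableSet.iInter fun n => (hset n).compl)

theorem measurable_srwReturnPos : Measurable srwReturnPos := by
  have h : Measurable (fun p : ℕ × (ℕ → ℤ × ℤ) => (srwPos p.2 p.1).1) :=
    measurable_from_prod_countable_right fun n => measurable_fst.comp (measurable_srwPos n)
  exact h.comp (measurable_srwReturnTime.prodMk measurable_id)

instance discreteCauchy_isProbabilityMeasure : IsProbabilityMeasure discreteCauchy :=
  Measure.isProbabilityMeasure_map measurable_srwReturnPos.aemeasurable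

/-! ### The `±1` step laws -/

/-- Mass `1/2` on each of `+1` and `-1`. -/
def signStep : Measure ℤ :=
  (2⁻¹ : ℝ≥0∞) • Measure.dirac 1 + (2⁻¹ : ℝ≥0∞) • Measure.dirac (-1)

/-- The lazy version: mass `1/4` on each of `+1` and `-1`, and mass `1/2` on `0`. -/
def lazySignStep : Measure ℤ :=
  (4⁻¹ : ℝ≥0∞) • Measure.dirac 1 + (4⁻¹ : ℝ≥0∞) • Measure.dirac (-1)
    + (2⁻¹ : ℝ≥0∞) • Measure.dirac 0

/-! ### Recurrence -/

/-- A process on `ℤ` is recurrent if almost surely it visits every integer infinitely often. -/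
def IsRecurrentProcess {Ω : Type u} [MeasurableSpace Ω] (μ : Measure Ω) (S : ℕ → Ω → ℤ) : Prop :=
  ∀ᵐ ω ∂μ, ∀ x : ℤ, ∃ᶠ n in atTop, S n ω = x

/-- A law on `ℤ` is recurrent if the random walk with i.i.d. steps of that law is. -/
def IsRecurrentLaw (P : Measure ℤ) : Prop :=
  ∀ (Ω : Type u) [MeasurableSpace Ω] (μ : Measure Ω) [IsProbabilityMeasure μ] (X : ℕ → Ω → ℤ),
    (∀ n, Measurable (X n)) → iIndepFun X μ → (∀ n, μ.map (X n) = P) →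
    IsRecurrentProcess μ (fun n ω => ∑ l ∈ Finset.range n, X l ω)

/-! ### Processes that mix several step laws -/

/-- `σ(f 0, …, f n)`. -/
abbrev sigmaUpTo {Ω : Type u} {β : Type v} [MeasurableSpace β] (f : ℕ → Ω → β) (n : ℕ) :
    MeasurableSpace Ω :=
  ⨆ l : ℕ, ⨆ _ : l ≤ n, MeasurableSpace.comap (f l) inferInstance

/-- `(S n, i n)` is a process such that, for every `n`, the conditional law of the increment
`S (n + 1) - S n` given `σ((S l, i l), l ≤ n) ∨ σ(i (n + 1))` is `P (i (n + 1))`. -/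
structure IsStepMixture {Ω : Type u} [MeasurableSpace Ω] (μ : Measure Ω)
    {ι : Type v} [MeasurableSpace ι] (P : ι → Measure ℤ)
    (S : ℕ → Ω → ℤ) (i : ℕ → Ω → ι) : Prop where
  measurable_pos : ∀ n, Measurable (S n)
  measurable_index : ∀ n, Measurable (i n)
  condLaw : ∀ (n : ℕ) (A : Set ℤ),
    μ⟦{ω | S (n + 1) ω - S n ω ∈ A} |
        sigmaUpTo S n ⊔ sigmaUpTo i n ⊔ MeasurableSpace.comap (i (n + 1)) inferInstance⟧
      =ᵐ[μ] fun ω => (P (i (n + 1) ω)).real A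

/-- Every process mixing the step laws `P j` (whatever the starting point, and whatever the rule,
possibly randomized, by which the indices are chosen) is recurrent. -/
def AllMixturesRecurrent {ι : Type v} [MeasurableSpace ι] (P : ι → Measure ℤ) : Prop :=
  ∀ (Ω : Type u) [MeasurableSpace Ω] (μ : Measure Ω) [IsProbabilityMeasure μ]
    (S : ℕ → Ω → ℤ) (i : ℕ → Ω → ι), IsStepMixture μ P S i → IsRecurrentProcess μ S

/-- The site `S n ω` is fresh: it has not been visited before time `n`. -/
def IsFresh {Ω : Type u} (S : ℕ → Ω → ℤ) (n : ℕ) (ω : Ω) : Prop :=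
  ∀ l < n, S l ω ≠ S n ω

open Classical in
/-- Benjamini's walk: given `S 0, …, S n`, the next step is a discrete Cauchy jump if `S n` is a
fresh site and a symmetric `±1` step otherwise. -/
structure IsBenjaminiWalk {Ω : Type u} [MeasurableSpace Ω] (μ : Measure Ω)
    (S : ℕ → Ω → ℤ) : Prop where
  measurable_pos : ∀ n, Measurable (S n)
  condLaw : ∀ (n : ℕ) (A : Set ℤ),
    μ⟦{ω | S (n + 1) ω - S n ω ∈ A} | sigmaUpTo S n⟧
      =ᵐ[μ] fun ω => if IsFresh S n ω then discreteCauchy.real A else signStep.real A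

end

/-!
The recurrence statements rest on one Lyapunov criterion, `allMixturesRecurrent_of_lyapunov`. If a
function `f ≥ 0` on `ℤ` with finite sublevel sets is superharmonic off `0` for every law of the
family, then, on the event that a mixture takes a given value at some time and avoids `0` from then
on, the mean of `f (S n)` does not increase, and it is finite. By Fatou's lemma `f (S n)` does
not tend to infinity on that event, so that some site is visited infinitely often. Since every law
charges `1` and `-1` with mass at least `1 / 4`, Lévy's conditional Borel–Cantelli lemma spreads this
from one site to its neighbours, hence to all of `ℤ`. No rule for the choice of the laws enters.

The Lyapunov function is the restriction to the horizontal axis of the function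
`log (|z| ^ 2 - 1 / 2) + log 126` on `ℤ²`, extended by `0` at the origin (`planePotential`). It
replaces the potential kernel of the planar walk. For `z = (x, y)` neither at the origin nor
adjacent to it, the product of the four values `|z'| ^ 2 - 1 / 2` at the neighbours `z'` of `z` equals
`(|z| ^ 2 - 1 / 2) ^ 4 - 4 * (x ^ 2 - y ^ 2) ^ 2`, so the function is superharmonic there for the
planar walk; the constant `log 126` makes it superharmonic at the neighbours of the origin as well
(`planePotential_superharmonic`). Since an excursion of this walk from a point
`(x, 0)` with `x ≠ 0` does not meet the origin before it is back on the axis, stopping it there and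
Fatou's lemma show that the restriction to the axis is superharmonic for the discrete Cauchy law off
`0` (`lintegral_planePotential_discreteCauchy_le`). The restriction is also concave off `0`, hence
superharmonic for both `±1` laws. In particular the lazy `±1` walk is recurrent, and it is the
vertical coordinate of the planar walk, which therefore returns to the axis.

Benjamini's walk is a mixture whose index records whether the current site is fresh.

For the removal of laziness, let `P j` be `Q j` conditioned to be nonzero. Then a step of law `Q j`
is a pause with probability `Q j {0}` and otherwise a step of law `P j`. Inserting such pauses,
decided by independent coins, into a mixture of the laws `P j` yields a mixture of the laws `Q j`
(`IsStepMixture.paused`). This mixture visits the same sites, and it makes only finitely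
many pauses in a row, so its recurrence implies that of the original one
(`IsStepMixture.isRecurrentProcess_of_paused`).
-/

/-! ### Mixtures through the joint law of the past and the next increment -/

/-- The past of a mixture just before its step number `n`: it includes the index `i (n + 1)` that
governs this step. -/
abbrev stepPast {Ω : Type u} {ι : Type v} [MeasurableSpace ι] (S : ℕ → Ω → ℤ) (i : ℕ → Ω → ι)
    (n : ℕ) : MeasurableSpace Ω :=
  sigmaUpTo S n ⊔ sigmaUpTo i n ⊔ MeasurableSpace.comap (i (n + 1)) inferInstance

theorem comap_le_sigmaUpTo {Ω : Type u} {β : Type v} [MeasurableSpace β] (f : ℕ → Ω → β)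
    {l n : ℕ} (h : l ≤ n) : MeasurableSpace.comap (f l) inferInstance ≤ sigmaUpTo f n :=
  le_iSup₂_of_le l h le_rfl

theorem sigmaUpTo_le {Ω : Type u} {β : Type v} [MeasurableSpace β] {f : ℕ → Ω → β}
    {n : ℕ} {m : MeasurableSpace Ω} (h : ∀ l ≤ n, Measurable[m] (f l)) : sigmaUpTo f n ≤ m :=
  iSup₂_le fun l hl => (h l hl).comap_le

theorem sigmaUpTo_mono {Ω : Type u} {β : Type v} [MeasurableSpace β] (f : ℕ → Ω → β) :
    Monotone (sigmaUpTo f) :=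
  fun _ _ hmn => iSup₂_le fun _ hl => comap_le_sigmaUpTo f (hl.trans hmn)

section StepPast

variable {Ω : Type u} {ι : Type v} [MeasurableSpace ι] {S : ℕ → Ω → ℤ} {i : ℕ → Ω → ι}

theorem stepPast_le {m : MeasurableSpace Ω} {n : ℕ} (hS : ∀ l ≤ n, Measurable[m] (S l))
    (hi : ∀ l ≤ n + 1, Measurable[m] (i l)) : stepPast S i n ≤ m :=
  sup_le (sup_le (sigmaUpTo_le hS) (sigmaUpTo_le fun l hl => hi l (by omega)))
    (hi _ le_rfl).comap_le

theorem measurable_stepPast_pos {l n : ℕ} (h : l ≤ n) : Measurable[stepPast S i n] (S l) :=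
  Measurable.of_comap_le
    ((comap_le_sigmaUpTo S h).trans (le_sup_left.trans le_sup_left))

theorem measurable_stepPast_index {l n : ℕ} (h : l ≤ n + 1) :
    Measurable[stepPast S i n] (i l) := by
  rcases Nat.le_succ_iff.1 h with h | rfl
  · exact Measurable.of_comap_le
      ((comap_le_sigmaUpTo i h).trans (le_sup_right.trans le_sup_left))
  · exact Measurable.of_comap_le le_sup_right

theorem stepPast_mono : Monotone (stepPast S i) := fun m n hmn =>
  stepPast_le (fun _ hl => measurable_stepPast_pos (hl.trans hmn))
    (fun _ hl => measurable_stepPast_index (hl.trans (by omega)))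

end StepPast

section Mixture

variable {Ω : Type u} [MeasurableSpace Ω] {μ : Measure Ω} {ι : Type v} [MeasurableSpace ι]
  {P : ι → Measure ℤ} {S : ℕ → Ω → ℤ} {i : ℕ → Ω → ι}

theorem IsStepMixture.stepPast_le (h : IsStepMixture μ P S i) (n : ℕ) :
    stepPast S i n ≤ ‹MeasurableSpace Ω› :=
  _root_.stepPast_le (fun l _ => h.measurable_pos l) (fun l _ => h.measurable_index l)

/-- On an event of the past on which the next index is `j`, the next increment is independent of
the past and has law `P j`. -/
theorem IsStepMixture.measure_inter_step [IsFiniteMeasure μ] [∀ j, IsFiniteMeasure (P j)]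
    [DiscreteMeasurableSpace ι] (h : IsStepMixture μ P S i) (n : ℕ) (j : ι) {B : Set Ω}
    (hB : MeasurableSet[stepPast S i n] B) (A : Set ℤ) :
    μ (B ∩ {ω | i (n + 1) ω = j} ∩ {ω | S (n + 1) ω - S n ω ∈ A})
      = μ (B ∩ {ω | i (n + 1) ω = j}) * P j A := by
  set C := B ∩ {ω | i (n + 1) ω = j} with hC
  have hCm : MeasurableSet[stepPast S i n] C :=
    hB.inter (measurable_stepPast_index le_rfl (measurableSet_singleton j))
  have hC0 : MeasurableSet C := h.stepPast_le n _ hCm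
  have hD : MeasurableSet {ω | S (n + 1) ω - S n ω ∈ A} :=
    ((h.measurable_pos (n + 1)).sub (h.measurable_pos n)) (MeasurableSet.of_discrete)
  have h1 := setIntegral_condExp (h.stepPast_le n) (μ := μ)
    ((integrable_const (1 : ℝ)).indicator hD) hCm
  have h2 : ∫ ω in C, (P (i (n + 1) ω)).real A ∂μ = μ.real C * (P j).real A := by
    rw [setIntegral_congr_fun hC0 (g := fun _ => (P j).real A)]
    · simp [mul_comm]
    · intro ω hω
      have : i (n + 1) ω = j := hω.2
      simp [this]
  rw [integral_congr_ae (ae_restrict_of_ae (h.condLaw n A)), h2,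
    setIntegral_indicator hD] at h1
  simp only [integral_const, MeasurableSet.univ, measureReal_restrict_apply, Set.univ_inter,
    smul_eq_mul, mul_one] at h1
  rw [← ENNReal.toReal_eq_toReal_iff' (measure_ne_top _ _)
    (ENNReal.mul_ne_top (measure_ne_top _ _) (measure_ne_top _ _)), ENNReal.toReal_mul]
  exact h1.symm

/-- Converse of `IsStepMixture.measure_inter_step`, for a countable index set. -/
theorem isStepMixture_of_measure_inter_step [IsFiniteMeasure μ] [∀ j, IsFiniteMeasure (P j)]
    [Countable ι] [DiscreteMeasurableSpace ι]
    (hS : ∀ n, Measurable (S n)) (hi : ∀ n, Measurable (i n))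
    (h : ∀ (n : ℕ) (j : ι) (B : Set Ω), MeasurableSet[stepPast S i n] B → ∀ k : ℤ,
      μ (B ∩ {ω | i (n + 1) ω = j} ∩ {ω | S (n + 1) ω - S n ω = k})
        = μ (B ∩ {ω | i (n + 1) ω = j}) * P j {k})
    (hP : ∀ j A, P j A ≤ 1) : IsStepMixture μ P S i := by
  refine ⟨hS, hi, fun n A => ?_⟩
  have hle : stepPast S i n ≤ ‹MeasurableSpace Ω› :=
    stepPast_le (fun l _ => hS l) (fun l _ => hi l)
  have hΔ : Measurable fun ω => S (n + 1) ω - S n ω := (hS (n + 1)).sub (hS n)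
  have hD : MeasurableSet {ω | S (n + 1) ω - S n ω ∈ A} := hΔ MeasurableSet.of_discrete
  have hg : Measurable[stepPast S i n] fun ω => (P (i (n + 1) ω)).real A :=
    (Measurable.of_discrete (f := fun j => (P j).real A)).comp
      (measurable_stepPast_index le_rfl)
  have hg1 : ∀ ω, ‖(P (i (n + 1) ω)).real A‖ ≤ 1 := fun ω => by
    rw [Real.norm_of_nonneg measureReal_nonneg]
    exact ENNReal.toReal_le_of_le_ofReal zero_le_one (by simpa using hP _ A)
  have hgi : Integrable (fun ω => (P (i (n + 1) ω)).real A) μ :=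
    Integrable.of_bound (hg.mono hle le_rfl).aestronglyMeasurable 1 (ae_of_all _ hg1)
  refine (ae_eq_condExp_of_forall_setIntegral_eq hle ((integrable_const (1 : ℝ)).indicator hD)
    (fun s _ _ => hgi.integrableOn) (fun B hB _ => ?_)
    hg.stronglyMeasurable.aestronglyMeasurable).symm
  have hB0 := hle _ hB
  have key : ∀ j, μ (B ∩ {ω | i (n + 1) ω = j} ∩ {ω | S (n + 1) ω - S n ω ∈ A})
      = μ (B ∩ {ω | i (n + 1) ω = j}) * P j A := by
    intro j
    have hm : Measure.map (fun ω => S (n + 1) ω - S n ω)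
        (μ.restrict (B ∩ {ω | i (n + 1) ω = j})) = μ (B ∩ {ω | i (n + 1) ω = j}) • P j := by
      refine Measure.ext_of_singleton fun k => ?_
      rw [Measure.map_apply hΔ (measurableSet_singleton k), Measure.restrict_apply
        (hΔ (measurableSet_singleton k)), Set.inter_comm, Measure.smul_apply, smul_eq_mul]
      exact h n j B hB k
    have := congrArg (fun m => m A) hm
    simp only [Measure.smul_apply, smul_eq_mul] at this
    rw [← this, Measure.map_apply hΔ MeasurableSet.of_discrete, Measure.restrict_apply
        (hΔ MeasurableSet.of_discrete), Set.inter_comm]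
    rfl
  have hl : ∫⁻ ω in B, P (i (n + 1) ω) A ∂μ = μ (B ∩ {ω | S (n + 1) ω - S n ω ∈ A}) := by
    have hU : B = ⋃ j, B ∩ {ω | i (n + 1) ω = j} := by
      ext ω; simp
    have hdis : Pairwise (Function.onFun Disjoint fun j => B ∩ {ω | i (n + 1) ω = j}) := by
      intro j k hjk
      refine Set.disjoint_left.2 fun ω h1 h2 => hjk (h1.2.symm.trans h2.2)
    have hms : ∀ j, MeasurableSet (B ∩ {ω | i (n + 1) ω = j}) := fun j =>
      hB0.inter (hi (n + 1) (measurableSet_singleton j))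
    conv_lhs => rw [hU]
    rw [lintegral_iUnion hms hdis]
    conv_rhs => rw [hU, Set.iUnion_inter]
    rw [measure_iUnion (hdis.mono fun j k hjk =>
      hjk.mono Set.inter_subset_left Set.inter_subset_left) (fun j => (hms j).inter hD)]
    refine tsum_congr fun j => ?_
    rw [key j, setLIntegral_congr_fun (hms j) (g := fun _ => P j A)]
    · simp [mul_comm]
    · intro ω hω
      have : i (n + 1) ω = j := hω.2
      simp [this]
  rw [setIntegral_indicator hD]
  simp only [integral_const, MeasurableSet.univ, measureReal_restrict_apply, Set.univ_inter,
    smul_eq_mul, mul_one]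
  rw [measureReal_def, ← hl]
  exact integral_toReal ((Measurable.of_discrete (f := fun j => P j A)).comp
      (hi (n + 1))).aemeasurable (ae_of_all _ fun ω => measure_lt_top _ _)

end Mixture

/-! ### Recurrence from a Lyapunov function -/

/-- If the increment `D` has law `κ` independently of the position `X` on the event `B`, a function
that is superharmonic for `κ` at the positions met on `B` decreases on average. -/
theorem setLIntegral_add_le {Ω : Type u} [MeasurableSpace Ω] {μ : Measure Ω} {E : Type v} [Add E]
    [Countable E] [MeasurableSpace E] [DiscreteMeasurableSpace E] {κ : Measure E}
    {X D : Ω → E} (hX : Measurable X) (hD : Measurable D) {B : Set Ω} (hB : MeasurableSet B)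
    (h : ∀ x e, μ (B ∩ {ω | X ω = x} ∩ {ω | D ω = e}) = μ (B ∩ {ω | X ω = x}) * κ {e})
    (f : E → ℝ≥0∞) (hf : ∀ ω ∈ B, ∫⁻ e, f (X ω + e) ∂κ ≤ f (X ω)) :
    ∫⁻ ω in B, f (X ω + D ω) ∂μ ≤ ∫⁻ ω in B, f (X ω) ∂μ := by
  have hU : B = ⋃ x, B ∩ {ω | X ω = x} := by
    ext ω; simp
  have hdis : Pairwise (Function.onFun Disjoint fun x => B ∩ {ω | X ω = x}) := by
    intro j k hjk
    exact Set.disjoint_left.2 fun ω h1 h2 => hjk (h1.2.symm.trans h2.2)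
  have hms : ∀ x, MeasurableSet (B ∩ {ω | X ω = x}) := fun x =>
    hB.inter (hX (measurableSet_singleton x))
  rw [hU, lintegral_iUnion hms hdis, lintegral_iUnion hms hdis]
  refine ENNReal.tsum_le_tsum fun x => ?_
  rcases (B ∩ {ω | X ω = x}).eq_empty_or_nonempty with he | ⟨ω, hω, rfl⟩
  · simp [he]
  have hm : Measure.map D (μ.restrict (B ∩ {ω' | X ω' = X ω}))
      = μ (B ∩ {ω' | X ω' = X ω}) • κ := by
    refine Measure.ext_of_singleton fun k => ?_
    rw [Measure.map_apply hD (measurableSet_singleton k), Measure.restrict_apply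
      (hD (measurableSet_singleton k)), Set.inter_comm, Measure.smul_apply, smul_eq_mul]
    exact h _ k
  calc ∫⁻ ω' in B ∩ {ω' | X ω' = X ω}, f (X ω' + D ω') ∂μ
      = ∫⁻ ω' in B ∩ {ω' | X ω' = X ω}, f (X ω + D ω') ∂μ := by
        refine setLIntegral_congr_fun (hms _) fun ω' hω' => ?_
        have : X ω' = X ω := hω'.2
        simp [this]
    _ = μ (B ∩ {ω' | X ω' = X ω}) * ∫⁻ e, f (X ω + e) ∂κ := by
        rw [← lintegral_map (f := fun e => f (X ω + e)) Measurable.of_discrete hD, hm,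
          lintegral_smul_measure, smul_eq_mul]
    _ ≤ μ (B ∩ {ω' | X ω' = X ω}) * f (X ω) := by gcongr; exact hf ω hω
    _ = ∫⁻ ω' in B ∩ {ω' | X ω' = X ω}, f (X ω') ∂μ := by
        rw [setLIntegral_congr_fun (hms _) (g := fun _ => f (X ω))]
        · simp [mul_comm]
        · intro ω' hω'
          have : X ω' = X ω := hω'.2
          simp [this]

section Lyapunov

variable {Ω : Type u} [MeasurableSpace Ω] {μ : Measure Ω} {ι : Type v} [MeasurableSpace ι]
  {P : ι → Measure ℤ} {S : ℕ → Ω → ℤ} {i : ℕ → Ω → ι}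

/-- If every law of the family charges `d` with mass at least `ε`, then a mixture that visits `z`
infinitely often also visits `z + d` infinitely often: this is Lévy's conditional form of the second
Borel–Cantelli lemma. -/
theorem IsStepMixture.frequently_add [IsFiniteMeasure μ] (h : IsStepMixture μ P S i) {ε : ℝ}
    (hε : 0 < ε) {d : ℤ} (hd : ∀ j, ε ≤ (P j).real {d}) (z : ℤ) :
    ∀ᵐ ω ∂μ, (∃ᶠ n in atTop, S n ω = z) → ∃ᶠ n in atTop, S n ω = z + d := by
  let ℱ : Filtration ℕ ‹MeasurableSpace Ω› := ⟨stepPast S i, stepPast_mono, h.stepPast_le⟩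
  -- the event of a step from `z` to `z + d` at time `n`; its value at `n = 0` is immaterial
  let s : ℕ → Set Ω := fun n =>
    {ω | S (n - 1) ω = z} ∩ {ω | S n ω - S (n - 1) ω ∈ ({d} : Set ℤ)}
  have hs : ∀ n, MeasurableSet[ℱ n] (s n) := fun n =>
    (measurable_stepPast_pos (S := S) (i := i) (Nat.sub_le n 1) (measurableSet_singleton z)).inter
      (Measurable.sub (measurable_stepPast_pos (S := S) (i := i) le_rfl)
        (measurable_stepPast_pos (S := S) (i := i) (Nat.sub_le n 1)) MeasurableSet.of_discrete)
  have hlow : ∀ᵐ ω ∂μ, ∀ n, {ω | S n ω = z}.indicator (fun _ => ε) ω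
      ≤ (μ[(s (n + 1)).indicator (1 : Ω → ℝ) | ℱ n]) ω := by
    refine ae_all_iff.2 fun n => ?_
    have hz : MeasurableSet[ℱ n] {ω | S n ω = z} :=
      measurable_stepPast_pos (S := S) (i := i) le_rfl (measurableSet_singleton z)
    have hD : MeasurableSet {ω | S (n + 1) ω - S n ω ∈ ({d} : Set ℤ)} :=
      ((h.measurable_pos (n + 1)).sub (h.measurable_pos n)) MeasurableSet.of_discrete
    have h1 := condExp_indicator (m := ℱ n) (μ := μ)
      ((integrable_const (1 : ℝ)).indicator hD) hz
    have h2 := h.condLaw n {d}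
    have h3 : (s (n + 1)).indicator (1 : Ω → ℝ) = {ω | S n ω = z}.indicator
        ({ω | S (n + 1) ω - S n ω ∈ ({d} : Set ℤ)}.indicator fun _ => (1 : ℝ)) := by
      rw [Set.indicator_indicator]; rfl
    rw [h3]
    filter_upwards [h1, h2] with ω h1 h2
    rw [h1]
    refine Set.indicator_le_indicator ?_
    exact (hd _).trans_eq h2.symm
  filter_upwards [hlow, ae_mem_limsup_atTop_iff (ℱ := ℱ) μ hs] with ω hlow hBC hfreq
  have hsum : Tendsto (fun n => ∑ k ∈ Finset.range n,
      (μ[(s (k + 1)).indicator (1 : Ω → ℝ) | ℱ k]) ω) atTop atTop := by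
    refine tendsto_atTop_mono (fun n => Finset.sum_le_sum fun k _ => hlow k) ?_
    have := Set.limsup_eq_tendsto_sum_indicator_atTop hε (fun n => {ω | S n ω = z})
    have hmem : ω ∈ limsup (fun n => {ω | S n ω = z}) atTop :=
      mem_limsup_iff_frequently_mem.2 hfreq
    rw [this] at hmem
    exact hmem
  have hlim := mem_limsup_iff_frequently_mem.1 (hBC.2 hsum)
  refine hlim.mono fun n hn => ?_
  have h1 : S (n - 1) ω = z := hn.1
  have h2 : S n ω - S (n - 1) ω = d := hn.2
  omega

/-- A family of laws on `ℤ` that uniformly charge `1` and `-1` and share a Lyapunov function, that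
is, a finite function with finite sublevel sets that is superharmonic off `0` for each of them, has
only recurrent mixtures. -/
theorem allMixturesRecurrent_of_lyapunov [Countable ι] [DiscreteMeasurableSpace ι]
    [∀ j, IsProbabilityMeasure (P j)] {ε : ℝ} (hε : 0 < ε) (hup : ∀ j, ε ≤ (P j).real {1})
    (hdown : ∀ j, ε ≤ (P j).real {-1}) (f : ℤ → ℝ≥0∞) (hf : ∀ x, f x ≠ ∞)
    (hfin : ∀ C : ℝ≥0∞, C ≠ ∞ → {x | f x ≤ C}.Finite)
    (hsuper : ∀ j x, x ≠ 0 → ∫⁻ k, f (x + k) ∂(P j) ≤ f x) :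
    AllMixturesRecurrent.{u} P := by
  intro Ω _ μ _ S i h
  have hS := h.measurable_pos
  -- the mean of `f (S n)` on the event that `0` is not visited between `N` and `n`
  have hdec : ∀ (N : ℕ) (y : ℤ) (n : ℕ),
      ∫⁻ ω in {ω | S N ω = y} ∩ {ω | ∀ l ≤ n, S (N + l) ω ≠ 0}, f (S (N + n) ω) ∂μ ≤ f y := by
    intro N y n
    have hA : ∀ n, MeasurableSet[stepPast S i (N + n)]
        ({ω | S N ω = y} ∩ {ω | ∀ l ≤ n, S (N + l) ω ≠ 0}) := by
      intro n
      refine (measurable_stepPast_pos (S := S) (i := i) (Nat.le_add_right N n)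
        (measurableSet_singleton y)).inter ?_
      simp only [Set.ofPred_forall]
      refine MeasurableSet.iInter fun l => MeasurableSet.iInter fun hl => ?_
      exact measurable_stepPast_pos (S := S) (i := i) (Nat.add_le_add_left hl N)
        (MeasurableSet.of_discrete (s := {x : ℤ | x ≠ 0}))
    induction n with
    | zero =>
      calc _ ≤ ∫⁻ ω in {ω | S N ω = y}, f (S (N + 0) ω) ∂μ :=
            lintegral_mono_set Set.inter_subset_left
        _ = ∫⁻ ω in {ω | S N ω = y}, f y ∂μ := by
            refine setLIntegral_congr_fun (hS N (measurableSet_singleton y)) fun ω hω => ?_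
            have : S N ω = y := hω
            simp [this]
        _ ≤ f y := by
            rw [setLIntegral_const]
            exact mul_le_of_le_one_right' prob_le_one
    | succ n ih =>
      refine le_trans ?_ ih
      set B := {ω | S N ω = y} ∩ {ω | ∀ l ≤ n, S (N + l) ω ≠ 0} with hB
      refine (lintegral_mono_set (t := B) fun ω hω =>
        ⟨hω.1, fun l hl => hω.2 l (by omega)⟩).trans ?_
      have hU : B = ⋃ j, B ∩ {ω | i (N + n + 1) ω = j} := by
        ext ω; simp
      have hdis : Pairwise (Function.onFun Disjoint fun j => B ∩ {ω | i (N + n + 1) ω = j}) := by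
        intro j k hjk
        exact Set.disjoint_left.2 fun ω h1 h2 => hjk (h1.2.symm.trans h2.2)
      have hms : ∀ j, MeasurableSet (B ∩ {ω | i (N + n + 1) ω = j}) := fun j =>
        (h.stepPast_le _ _ (hA n)).inter (h.measurable_index _ (measurableSet_singleton j))
      rw [hU, lintegral_iUnion hms hdis, lintegral_iUnion hms hdis]
      refine ENNReal.tsum_le_tsum fun j => ?_
      have := setLIntegral_add_le (μ := μ) (κ := P j) (hS (N + n))
        ((hS (N + n + 1)).sub (hS (N + n)))
        (hms j) (fun x e => ?_) f (fun ω hω => hsuper j _ (hω.1.2 n le_rfl))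
      · simpa [← add_assoc] using this
      · have := h.measure_inter_step (N + n) j ((hA n).inter (measurable_stepPast_pos (S := S)
          (i := i) (le_refl (N + n)) (measurableSet_singleton x))) {e}
        convert this using 2
        · ext ω; simp only [Set.mem_inter_iff, Set.mem_ofPred_eq, Set.mem_singleton_iff,
            Pi.sub_apply, Set.mem_preimage, B]; tauto
        · congr 1
          ext ω; simp only [Set.mem_inter_iff, Set.mem_ofPred_eq, Set.mem_singleton_iff,
            Set.mem_preimage, B]; tauto
  -- by Fatou's lemma, a mixture that avoids `0` keeps returning to a finite sublevel set of `f`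
  have hsome : ∀ᵐ ω ∂μ, ∃ z, ∃ᶠ n in atTop, S n ω = z := by
    have hNy : ∀ᵐ ω ∂μ, ∀ (N : ℕ) (y : ℤ), S N ω = y → (∀ l, S (N + l) ω ≠ 0) →
        ∃ z, ∃ᶠ n in atTop, S n ω = z := by
      refine ae_all_iff.2 fun N => ae_all_iff.2 fun y => ?_
      set B := {ω | S N ω = y} ∩ {ω | ∀ l, S (N + l) ω ≠ 0} with hB
      have hBm : MeasurableSet B := by
        refine (hS N (measurableSet_singleton y)).inter ?_
        simp only [Set.ofPred_forall]
        exact MeasurableSet.iInter fun l =>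
          hS (N + l) (MeasurableSet.of_discrete (s := {x : ℤ | x ≠ 0}))
      have hfS : ∀ n, Measurable fun ω => f (S (N + n) ω) := fun n =>
        (Measurable.of_discrete (f := f)).comp (hS (N + n))
      have hlt : ∫⁻ ω in B, liminf (fun n => f (S (N + n) ω)) atTop ∂μ ≤ f y := by
        refine (lintegral_liminf_le hfS).trans ?_
        refine (liminf_le_liminf (v := fun _ => f y) (Eventually.of_forall fun n => ?_)).trans_eq
          (liminf_const _)
        refine le_trans (lintegral_mono_set ?_) (hdec N y n)
        exact fun ω hω => ⟨hω.1, fun l _ => hω.2 l⟩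
      have hae := ae_lt_top (Measurable.liminf hfS) (hlt.trans_lt (hf y).lt_top).ne
      rw [ae_restrict_iff' hBm] at hae
      filter_upwards [hae] with ω hω h1 h2
      have hlt := hω ⟨h1, h2⟩
      obtain ⟨C, hC1, hC2⟩ := exists_between hlt
      have hfr : ∃ᶠ n in atTop, f (S (N + n) ω) < C :=
        frequently_lt_of_liminf_lt (by isBoundedDefault) hC1
      have hfr' : ∃ᶠ n in atTop, ∃ z ∈ {x | f x ≤ C}, S (N + n) ω = z :=
        hfr.mono fun n hn => ⟨_, hn.le, rfl⟩
      obtain ⟨z, -, hz⟩ := (hfin C hC2.ne).frequently_exists.1 hfr'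
      exact ⟨z, (tendsto_atTop_mono (fun n => Nat.le_add_left n N) tendsto_id).frequently hz⟩
    filter_upwards [hNy] with ω hω
    by_cases h0 : ∃ N, ∀ l, S (N + l) ω ≠ 0
    · obtain ⟨N, hN⟩ := h0
      exact hω N _ rfl hN
    · push Not at h0
      refine ⟨0, frequently_atTop.2 fun N => ?_⟩
      obtain ⟨l, hl⟩ := h0 N
      exact ⟨N + l, by omega, hl⟩
  have hu := ae_all_iff.2 fun z => h.frequently_add hε hup z
  have hd := ae_all_iff.2 fun z => h.frequently_add hε hdown z
  filter_upwards [hsome, hu, hd] with ω ⟨z, hz⟩ hu hd x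
  induction x using Int.inductionOn' (b := z) with
  | zero => exact hz
  | succ k _ ih => exact hu k ih
  | pred k _ ih => exact hd k ih

end Lyapunov

noncomputable section

/-! ### Independent steps -/

/-- `σ(X 0, …, X (n - 1))`. -/
abbrev sigmaBefore {Ω : Type u} {E : Type v} [MeasurableSpace E] (X : ℕ → Ω → E) (n : ℕ) :
    MeasurableSpace Ω :=
  ⨆ l ∈ Set.Iio n, MeasurableSpace.comap (X l) inferInstance

theorem measurable_sigmaBefore {Ω : Type u} {E : Type v} [MeasurableSpace E] (X : ℕ → Ω → E)
    {l n : ℕ} (h : l < n) : Measurable[sigmaBefore X n] (X l) :=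
  Measurable.of_comap_le (le_iSup₂_of_le l h le_rfl)

theorem sigmaBefore_le {Ω : Type u} [m : MeasurableSpace Ω] {E : Type v} [MeasurableSpace E]
    {X : ℕ → Ω → E} (hX : ∀ n, Measurable (X n)) (n : ℕ) : sigmaBefore X n ≤ m :=
  iSup₂_le fun l _ => (hX l).comap_le

theorem measure_inter_preimage_of_iIndepFun {Ω : Type u} [MeasurableSpace Ω] {μ : Measure Ω}
    {E : Type v} [MeasurableSpace E] {X : ℕ → Ω → E} (hX : ∀ n, Measurable (X n))
    (hind : iIndepFun X μ) (n : ℕ) {B : Set Ω}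
    (hB : MeasurableSet[sigmaBefore X n] B)
    {A : Set E} (hA : MeasurableSet A) :
    μ (B ∩ X n ⁻¹' A) = μ B * μ.map (X n) A := by
  have h := indep_iSup_of_disjoint (fun l => (hX l).comap_le) hind.iIndep
    (S := Set.Iio n) (T := {n}) (by simp)
  rw [Measure.map_apply (hX n) hA]
  refine (Indep_iff _ _ _).1 h B _ hB ?_
  exact le_iSup₂_of_le (f := fun l (_ : l ∈ ({n} : Set ℕ)) =>
    MeasurableSpace.comap (X l) inferInstance) n rfl le_rfl _ ⟨A, hA, rfl⟩

theorem isRecurrentLaw_of_allMixturesRecurrent {P : Measure ℤ} [IsProbabilityMeasure P]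
    (h : AllMixturesRecurrent.{u} fun _ : Unit => P) : IsRecurrentLaw.{u} P := by
  intro Ω _ μ _ X hX hind hlaw
  refine h Ω μ _ (fun _ _ => ()) (isStepMixture_of_measure_inter_step
    (fun n => Finset.measurable_sum _ fun l _ => hX l) (fun _ => measurable_const)
    (fun n j B hB k => ?_) (fun _ _ => prob_le_one))
  have hle : stepPast (fun n ω => ∑ l ∈ Finset.range n, X l ω) (fun _ _ => ()) n
      ≤ sigmaBefore X n := by
    refine stepPast_le (fun l hl => Finset.measurable_sum _ fun r hr => ?_)
      (fun _ _ => measurable_const)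
    exact measurable_sigmaBefore X ((Finset.mem_range.1 hr).trans_le hl)
  have := measure_inter_preimage_of_iIndepFun hX hind n (hle _ hB) (measurableSet_singleton k)
  rw [hlaw] at this
  simpa [Finset.sum_range_succ, Set.preimage] using this

/-! ### A potential on the plane -/

/-- The exponential of `planePotential`: up to a constant factor it is `|z| ^ 2 - 1 / 2` off the
origin. -/
def planeWeight (z : ℤ × ℤ) : ℝ := if z = 0 then 1 else 126 * ((z.1 : ℝ) ^ 2 + (z.2 : ℝ) ^ 2) - 63

/-- The explicit substitute `log (|z| ^ 2 - 1 / 2) + log 126` for the potential kernel of the simple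
random walk on `ℤ²`, with the value `0` at the origin. The shift `1 / 2` makes it superharmonic
off the origin, and the constant is the least one that allows a nonnegative value at the origin. -/
def planePotential (z : ℤ × ℤ) : ℝ≥0∞ := ENNReal.ofReal (Real.log (planeWeight z))

theorem one_le_planeWeight (z : ℤ × ℤ) : 1 ≤ planeWeight z := by
  unfold planeWeight
  split_ifs with h
  · exact le_rfl
  · have h1 : 1 ≤ z.1 ^ 2 + z.2 ^ 2 := by
      by_contra! h2
      have h3 : z.1 = 0 := by nlinarith [sq_nonneg z.1, sq_nonneg z.2]
      have h4 : z.2 = 0 := by nlinarith [sq_nonneg z.1, sq_nonneg z.2]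
      exact h (Prod.ext h3 h4)
    have h2 : (1 : ℝ) ≤ (z.1 : ℝ) ^ 2 + (z.2 : ℝ) ^ 2 := by exact_mod_cast h1
    linarith

theorem planeWeight_pos (z : ℤ × ℤ) : 0 < planeWeight z :=
  zero_lt_one.trans_le (one_le_planeWeight z)

theorem planeWeight_of_ne {x y : ℤ} (h : x ≠ 0 ∨ y ≠ 0) :
    planeWeight (x, y) = 126 * ((x : ℝ) ^ 2 + (y : ℝ) ^ 2) - 63 := by
  rw [planeWeight, if_neg]
  intro h0
  rw [Prod.ext_iff] at h0
  simp only [Prod.fst_zero, Prod.snd_zero] at h0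
  tauto

theorem planeWeight_neighbours_le {x y : ℤ} (h : x ≠ 0 ∨ y ≠ 0) :
    planeWeight (x + 1, y) * planeWeight (x - 1, y) *
      (planeWeight (x, y + 1) * planeWeight (x, y - 1)) ≤ planeWeight (x, y) ^ 4 := by
  by_cases h1 : (x = 1 ∨ x = -1) ∧ y = 0
  · rcases h1 with ⟨rfl | rfl, rfl⟩ <;> norm_num [planeWeight]
  by_cases h2 : x = 0 ∧ (y = 1 ∨ y = -1)
  · rcases h2 with ⟨rfl, rfl | rfl⟩ <;> norm_num [planeWeight]
  rw [planeWeight_of_ne h, planeWeight_of_ne (by omega), planeWeight_of_ne (by omega),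
    planeWeight_of_ne (by omega), planeWeight_of_ne (by omega)]
  push_cast
  -- the difference of the two sides is `126 ^ 4 * 4 * (x ^ 2 - y ^ 2) ^ 2`
  have := mul_nonneg (show (0 : ℝ) ≤ 126 ^ 4 * 4 by norm_num)
    (sq_nonneg ((x : ℝ) ^ 2 - (y : ℝ) ^ 2))
  linarith

theorem planeWeight_axis_le {x : ℤ} (h : x ≠ 0) :
    planeWeight (x + 1, 0) * planeWeight (x - 1, 0) ≤ planeWeight (x, 0) ^ 2 := by
  by_cases h1 : x = 1 ∨ x = -1
  · rcases h1 with rfl | rfl <;> norm_num [planeWeight]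
  rw [planeWeight_of_ne (by omega), planeWeight_of_ne (by omega), planeWeight_of_ne (by omega)]
  push_cast
  nlinarith [sq_nonneg (x : ℝ)]

theorem log_planeWeight_nonneg (z : ℤ × ℤ) : 0 ≤ Real.log (planeWeight z) :=
  Real.log_nonneg (one_le_planeWeight z)

theorem planePotential_superharmonic {z : ℤ × ℤ} (hz : z ≠ 0) :
    ∫⁻ e, planePotential (z + e) ∂srwStep ≤ planePotential z := by
  obtain ⟨x, y⟩ := z
  have hxy : x ≠ 0 ∨ y ≠ 0 := by
    by_contra! h
    exact hz (Prod.ext h.1 h.2)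
  have hpos := planeWeight_pos
  have h := Real.log_le_log (mul_pos (mul_pos (hpos _) (hpos _)) (mul_pos (hpos _) (hpos _)))
    (planeWeight_neighbours_le hxy)
  rw [Real.log_mul (mul_pos (hpos _) (hpos _)).ne' (mul_pos (hpos _) (hpos _)).ne',
    Real.log_mul (hpos _).ne' (hpos _).ne', Real.log_mul (hpos _).ne' (hpos _).ne',
    Real.log_pow] at h
  push_cast at h
  have h4 : (4⁻¹ : ℝ≥0∞) = ENNReal.ofReal 4⁻¹ := by
    rw [ENNReal.ofReal_inv_of_pos (by norm_num)]; norm_num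
  simp only [srwStep, lintegral_smul_measure, lintegral_add_measure, lintegral_dirac,
    Prod.mk_add_mk, add_zero, smul_eq_mul, planePotential, h4]
  have hn := log_planeWeight_nonneg
  rw [← ENNReal.ofReal_add (hn _) (hn _), ← ENNReal.ofReal_add (add_nonneg (hn _) (hn _)) (hn _),
    ← ENNReal.ofReal_add (add_nonneg (add_nonneg (hn _) (hn _)) (hn _)) (hn _),
    ← ENNReal.ofReal_mul (by norm_num)]
  refine ENNReal.ofReal_le_ofReal ?_
  simp only [← sub_eq_add_neg]
  linarith

theorem planePotential_axis_add_le {x : ℤ} (hx : x ≠ 0) :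
    planePotential (x + 1, 0) + planePotential (x - 1, 0) ≤ 2 * planePotential (x, 0) := by
  have hpos := planeWeight_pos
  have h := Real.log_le_log (mul_pos (hpos _) (hpos _)) (planeWeight_axis_le hx)
  rw [Real.log_mul (hpos _).ne' (hpos _).ne', Real.log_pow] at h
  push_cast at h
  have h2 : (2 : ℝ≥0∞) = ENNReal.ofReal 2 := by simp
  have hn := log_planeWeight_nonneg
  rw [planePotential, planePotential, planePotential, ← ENNReal.ofReal_add (hn _) (hn _), h2,
    ← ENNReal.ofReal_mul (by norm_num)]
  exact ENNReal.ofReal_le_ofReal h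

theorem finite_setOf_planePotential_axis_le {C : ℝ≥0∞} (hC : C ≠ ∞) :
    {x : ℤ | planePotential (x, 0) ≤ C}.Finite := by
  refine (Set.finite_Icc (-⌈Real.exp C.toReal⌉) ⌈Real.exp C.toReal⌉).subset fun x hx => ?_
  have hx' : Real.log (planeWeight (x, 0)) ≤ C.toReal := (ENNReal.ofReal_le_iff_le_toReal hC).1 hx
  have hpos := planeWeight_pos (x, 0)
  have h1 : planeWeight (x, 0) ≤ Real.exp C.toReal := (Real.log_le_iff_le_exp hpos).1 hx'
  have h2 : |(x : ℝ)| ≤ planeWeight (x, 0) := by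
    by_cases hx0 : x = 0
    · rw [hx0, Int.cast_zero, abs_zero]
      exact (planeWeight_pos _).le
    · rw [planeWeight_of_ne (Or.inl hx0)]
      have h3 : (1 : ℝ) ≤ |(x : ℝ)| := by exact_mod_cast Int.one_le_abs hx0
      push_cast
      nlinarith [sq_abs (x : ℝ)]
  have h4 : |x| ≤ ⌈Real.exp C.toReal⌉ := by
    have : ((|x| : ℤ) : ℝ) ≤ ⌈Real.exp C.toReal⌉ := by
      push_cast
      exact h2.trans (h1.trans (Int.le_ceil _))
    exact_mod_cast this
  exact abs_le.1 h4

theorem planePotential_ne_top (z : ℤ × ℤ) : planePotential z ≠ ∞ := ENNReal.ofReal_ne_top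

theorem lintegral_planePotential_signStep_le {x : ℤ} (hx : x ≠ 0) :
    ∫⁻ k, planePotential (x + k, 0) ∂signStep ≤ planePotential (x, 0) := by
  simp only [signStep, lintegral_smul_measure, lintegral_add_measure, lintegral_dirac, smul_eq_mul,
    ← sub_eq_add_neg]
  rw [← mul_add, ENNReal.inv_mul_le_iff (by norm_num) (by norm_num)]
  exact planePotential_axis_add_le hx

theorem inv_four_add_inv_four : (4⁻¹ : ℝ≥0∞) + 4⁻¹ = 2⁻¹ := by
  rw [show (4 : ℝ≥0∞) = 2 * 2 by norm_num, ENNReal.mul_inv (by norm_num) (by norm_num), ← mul_add,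
    ENNReal.inv_two_add_inv_two, mul_one]

theorem lintegral_planePotential_lazySignStep_le {x : ℤ} (hx : x ≠ 0) :
    ∫⁻ k, planePotential (x + k, 0) ∂lazySignStep ≤ planePotential (x, 0) := by
  simp only [lazySignStep, lintegral_smul_measure, lintegral_add_measure, lintegral_dirac,
    smul_eq_mul, ← sub_eq_add_neg, add_zero]
  rw [← mul_add]
  calc 4⁻¹ * (planePotential (x + 1, 0) + planePotential (x - 1, 0)) + 2⁻¹ * planePotential (x, 0)
      ≤ 4⁻¹ * (2 * planePotential (x, 0)) + 2⁻¹ * planePotential (x, 0) := by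
        gcongr; exact planePotential_axis_add_le hx
    _ = (2⁻¹ + 2⁻¹) * planePotential (x, 0) := by
        rw [← mul_assoc, add_mul]
        rw [mul_two, inv_four_add_inv_four]
    _ = planePotential (x, 0) := by rw [ENNReal.inv_two_add_inv_two, one_mul]

/-! ### The `±1` step laws -/

instance signStep_isProbabilityMeasure : IsProbabilityMeasure signStep := by
  constructor
  simp [signStep, ENNReal.inv_two_add_inv_two]

instance lazySignStep_isProbabilityMeasure : IsProbabilityMeasure lazySignStep := by
  constructor
  simp [lazySignStep, inv_four_add_inv_four, ENNReal.inv_two_add_inv_two]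

/-- The vertical coordinate of a planar step is a lazy `±1` step. -/
theorem map_snd_srwStep : srwStep.map Prod.snd = lazySignStep := by
  ext A hA
  simp only [srwStep, lazySignStep, Measure.map_smul, Measure.map_add _ _ measurable_snd,
    Measure.map_dirac' measurable_snd, Measure.smul_apply, Measure.add_apply, smul_eq_mul]
  rw [← inv_four_add_inv_four]
  ring

theorem le_real_of_inv_four_le {P : Measure ℤ} [IsFiniteMeasure P] {A : Set ℤ} (h : 4⁻¹ ≤ P A) :
    (4⁻¹ : ℝ) ≤ P.real A := by
  have := ENNReal.toReal_mono (measure_ne_top P A) h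
  simpa [measureReal_def] using this

theorem inv_four_le_signStep_one : 4⁻¹ ≤ signStep {1} := by
  simp only [signStep, Measure.add_apply, Measure.smul_apply, smul_eq_mul]
  simp
  norm_num

theorem inv_four_le_signStep_neg_one : 4⁻¹ ≤ signStep {-1} := by
  simp only [signStep, Measure.add_apply, Measure.smul_apply, smul_eq_mul]
  simp
  norm_num

theorem inv_four_le_lazySignStep_one : 4⁻¹ ≤ lazySignStep {1} := by
  simp only [lazySignStep, Measure.add_apply, Measure.smul_apply, smul_eq_mul]
  simp

theorem inv_four_le_lazySignStep_neg_one : 4⁻¹ ≤ lazySignStep {-1} := by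
  simp only [lazySignStep, Measure.add_apply, Measure.smul_apply, smul_eq_mul]
  simp

theorem allMixturesRecurrent_of_planePotential {ι : Type v} [MeasurableSpace ι] [Countable ι]
    [DiscreteMeasurableSpace ι] {P : ι → Measure ℤ} [∀ j, IsProbabilityMeasure (P j)]
    (hup : ∀ j, 4⁻¹ ≤ P j {1}) (hdown : ∀ j, 4⁻¹ ≤ P j {-1})
    (hP : ∀ j x, x ≠ 0 → ∫⁻ k, planePotential (x + k, 0) ∂(P j) ≤ planePotential (x, 0)) :
    AllMixturesRecurrent.{u} P :=
  allMixturesRecurrent_of_lyapunov (ε := 4⁻¹) (by norm_num)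
    (fun j => le_real_of_inv_four_le (hup j)) (fun j => le_real_of_inv_four_le (hdown j))
    (fun x => planePotential (x, 0)) (fun _ => planePotential_ne_top _)
    (fun _ hC => finite_setOf_planePotential_axis_le hC) hP

/-! ### The discrete Cauchy law -/

theorem measurePreserving_srwLaw_eval (n : ℕ) :
    MeasurePreserving (fun ξ : ℕ → ℤ × ℤ => ξ n) srwLaw srwStep :=
  measurePreserving_eval_infinitePi (fun _ : ℕ => srwStep) n

theorem iIndepFun_srwLaw : iIndepFun (fun n (ξ : ℕ → ℤ × ℤ) => ξ n) srwLaw :=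
  iIndepFun_infinitePi (P := fun _ : ℕ => srwStep) (X := fun _ x => x) fun _ => measurable_id

theorem srwPos_snd (ξ : ℕ → ℤ × ℤ) (n : ℕ) :
    (srwPos ξ n).2 = ∑ l ∈ Finset.range n, (ξ l).2 := by
  simp [srwPos, Prod.snd_sum]

/-- The vertical coordinate performs a lazy `±1` walk, which is recurrent. -/
theorem ae_exists_srwPos_snd_eq_zero :
    ∀ᵐ ξ ∂srwLaw, ∃ n : ℕ, 0 < n ∧ (srwPos ξ n).2 = 0 := by
  have h : IsRecurrentLaw.{0} lazySignStep := isRecurrentLaw_of_allMixturesRecurrent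
    (allMixturesRecurrent_of_planePotential (fun _ => inv_four_le_lazySignStep_one)
      (fun _ => inv_four_le_lazySignStep_neg_one)
      fun _ _ => lintegral_planePotential_lazySignStep_le)
  have h1 := h (ℕ → ℤ × ℤ) srwLaw (fun n ξ => (ξ n).2)
    (fun n => measurable_snd.comp (measurable_pi_apply n))
    (iIndepFun_srwLaw.comp (fun _ => Prod.snd) fun _ => measurable_snd) (fun n => by
      rw [← map_snd_srwStep, ← (measurePreserving_srwLaw_eval n).map_eq,
        Measure.map_map measurable_snd (measurable_pi_apply n)]
      rfl)
  filter_upwards [h1] with ξ hξ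
  obtain ⟨n, hn, h0⟩ := (frequently_atTop.1 (hξ 0)) 1
  exact ⟨n, hn, (srwPos_snd ξ n).trans h0⟩

theorem inv_four_le_discreteCauchy {k : ℤ} (hk : 4⁻¹ ≤ srwStep {(k, 0)}) :
    4⁻¹ ≤ discreteCauchy {k} := by
  rw [discreteCauchy, Measure.map_apply measurable_srwReturnPos (measurableSet_singleton k)]
  rw [← (measurePreserving_srwLaw_eval 0).map_eq,
    Measure.map_apply (measurable_pi_apply 0) (measurableSet_singleton _)] at hk
  refine hk.trans (measure_mono fun ξ hξ => ?_)
  have h0 : ξ 0 = (k, 0) := hξ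
  have h1 : srwPos ξ 1 = (k, 0) := by simp [srwPos, h0]
  have hT : srwReturnTime ξ = 1 := by
    have hm : 1 ∈ {n : ℕ | 0 < n ∧ (srwPos ξ n).2 = 0} := ⟨one_pos, by rw [h1]⟩
    exact le_antisymm (Nat.sInf_le hm) (Nat.sInf_mem ⟨1, hm⟩).1
  change (srwPos ξ (srwReturnTime ξ)).1 = k
  rw [hT, h1]

theorem inv_four_le_discreteCauchy_one : 4⁻¹ ≤ discreteCauchy {1} := by
  refine inv_four_le_discreteCauchy ?_
  simp only [srwStep, Measure.add_apply, Measure.smul_apply, smul_eq_mul]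
  simp

theorem inv_four_le_discreteCauchy_neg_one : 4⁻¹ ≤ discreteCauchy {-1} := by
  refine inv_four_le_discreteCauchy ?_
  simp only [srwStep, Measure.add_apply, Measure.smul_apply, smul_eq_mul]
  simp

/-- The event that the walk does not visit the horizontal axis at the times `1, …, n`. -/
def srwNoReturn (n : ℕ) : Set (ℕ → ℤ × ℤ) := {ξ | ∀ l, 0 < l → l ≤ n → (srwPos ξ l).2 ≠ 0}

theorem measurable_srwPos_past {n l : ℕ} (h : l ≤ n) :
    Measurable[sigmaBefore (fun r (ξ : ℕ → ℤ × ℤ) => ξ r) n] (fun ξ => srwPos ξ l) :=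
  Finset.measurable_sum _ fun _ hr => measurable_sigmaBefore (fun r (ξ : ℕ → ℤ × ℤ) => ξ r)
    ((Finset.mem_range.1 hr).trans_le h)

theorem measurableSet_srwNoReturn_past (n : ℕ) :
    MeasurableSet[sigmaBefore (fun r (ξ : ℕ → ℤ × ℤ) => ξ r) n] (srwNoReturn n) := by
  simp only [srwNoReturn, Set.ofPred_forall]
  refine MeasurableSet.iInter fun l => MeasurableSet.iInter fun _ =>
    MeasurableSet.iInter fun h => ?_
  exact measurable_srwPos_past h (MeasurableSet.of_discrete (s := {z : ℤ × ℤ | z.2 ≠ 0}))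

theorem measurableSet_srwNoReturn (n : ℕ) : MeasurableSet (srwNoReturn n) :=
  sigmaBefore_le measurable_pi_apply n _ (measurableSet_srwNoReturn_past n)

/-- The position of the walk stopped at its first return to the horizontal axis. -/
def srwStopped (n : ℕ) (ξ : ℕ → ℤ × ℤ) : ℤ × ℤ := by
  classical exact if ξ ∈ srwNoReturn n then srwPos ξ n else srwPos ξ (srwReturnTime ξ)

theorem measurable_srwStopped (n : ℕ) : Measurable (srwStopped n) := by
  classical
  have h : Measurable (fun p : ℕ × (ℕ → ℤ × ℤ) => srwPos p.2 p.1) :=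
    measurable_from_prod_countable_right fun n => measurable_srwPos n
  exact Measurable.ite (measurableSet_srwNoReturn n)
    (measurable_srwPos n) (h.comp (measurable_srwReturnTime.prodMk measurable_id))

/-- Until its first return to the horizontal axis, the walk started from `(x, 0)` does not meet the
origin after time `0`; so the potential of the stopped walk is a supermartingale. -/
theorem lintegral_planePotential_srwStopped_le {x : ℤ} (hx : x ≠ 0) (n : ℕ) :
    ∫⁻ ξ, planePotential ((x, 0) + srwStopped n ξ) ∂srwLaw ≤ planePotential (x, 0) := by
  classical
  induction n with
  | zero =>
    have : ∀ ξ, srwStopped 0 ξ = 0 := fun ξ => by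
      have : ξ ∈ srwNoReturn 0 := fun l h1 h2 => by omega
      simp [srwStopped, this, srwPos]
    simp [this]
  | succ n ih =>
    refine le_trans ?_ ih
    have hBp := measurableSet_srwNoReturn_past n
    have hB := measurableSet_srwNoReturn n
    rw [← lintegral_add_compl _ hB, ← lintegral_add_compl (fun ξ => planePotential
      ((x, 0) + srwStopped n ξ)) hB]
    refine add_le_add ?_ (le_of_eq ?_)
    · have h1 := setLIntegral_add_le (μ := srwLaw) (κ := srwStep)
        (X := fun ξ => (x, 0) + srwPos ξ n) (D := fun ξ => ξ n)
        ((measurable_srwPos n).const_add _) (measurable_pi_apply n) hB (fun z e => ?_)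
        planePotential (fun ξ hξ => planePotential_superharmonic ?_)
      · refine le_trans (le_of_eq ?_) (h1.trans (le_of_eq ?_))
        · refine setLIntegral_congr_fun hB fun ξ hξ => ?_
          have : srwStopped (n + 1) ξ = srwPos ξ (n + 1) := by
            by_cases h : ξ ∈ srwNoReturn (n + 1)
            · simp [srwStopped, h]
            · have hv : (srwPos ξ (n + 1)).2 = 0 := by
                by_contra hv
                refine h fun l h1 h2 => ?_
                rcases Nat.le_succ_iff.1 h2 with h2 | rfl
                exacts [hξ l h1 h2, hv]
              have hT : srwReturnTime ξ = n + 1 := by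
                have hm : n + 1 ∈ {n : ℕ | 0 < n ∧ (srwPos ξ n).2 = 0} := ⟨n.succ_pos, hv⟩
                have hs := Nat.sInf_mem ⟨_, hm⟩
                refine le_antisymm (Nat.sInf_le hm) ?_
                by_contra! hlt
                exact hξ _ hs.1 (Nat.lt_succ_iff.1 hlt) hs.2
              simp [srwStopped, h, hT]
          simp [this, srwPos, Finset.sum_range_succ, add_assoc]
        · refine setLIntegral_congr_fun hB fun ξ hξ => ?_
          simp [srwStopped, hξ]
      · have := measure_inter_preimage_of_iIndepFun (fun n => measurable_pi_apply n)
          iIndepFun_srwLaw n (hBp.inter (((measurable_srwPos_past le_rfl).const_add (x, 0))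
            (measurableSet_singleton z))) (measurableSet_singleton e)
        rw [(measurePreserving_srwLaw_eval n).map_eq] at this
        exact this
      · rcases n.eq_zero_or_pos with rfl | hn
        · simpa [srwPos] using hx
        · intro h0
          have := congrArg Prod.snd h0
          exact hξ n hn le_rfl (by simpa using this)
    · refine setLIntegral_congr_fun hB.compl fun ξ hξ => ?_
      have h1 : ξ ∉ srwNoReturn n := hξ
      have h2 : ξ ∉ srwNoReturn (n + 1) := fun h => h1 fun l hl hln => h l hl (by omega)
      simp [srwStopped, h1, h2]

/-- By Fatou's lemma, the supermartingale bound for the stopped walk passes to its position at the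
first return, which is finite almost surely. -/
theorem lintegral_planePotential_discreteCauchy_le {x : ℤ} (hx : x ≠ 0) :
    ∫⁻ k, planePotential (x + k, 0) ∂discreteCauchy ≤ planePotential (x, 0) := by
  classical
  rw [discreteCauchy, lintegral_map Measurable.of_discrete measurable_srwReturnPos]
  have hlim : ∀ᵐ ξ ∂srwLaw, planePotential (x + srwReturnPos ξ, 0)
      = liminf (fun n => planePotential ((x, 0) + srwStopped n ξ)) atTop := by
    filter_upwards [ae_exists_srwPos_snd_eq_zero] with ξ hξ
    have hT : 0 < srwReturnTime ξ ∧ (srwPos ξ (srwReturnTime ξ)).2 = 0 := Nat.sInf_mem hξ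
    refine (Tendsto.liminf_eq (tendsto_const_nhds.congr' ?_)).symm
    filter_upwards [eventually_ge_atTop (srwReturnTime ξ)] with n hn
    have : ξ ∉ srwNoReturn n := fun h => h _ hT.1 hn hT.2
    congr 1
    ext <;> simp [srwStopped, this, srwReturnPos, hT.2]
  rw [lintegral_congr_ae hlim]
  refine (lintegral_liminf_le fun n => (Measurable.of_discrete (f := planePotential)).comp
    ((measurable_srwStopped n).const_add _)).trans ?_
  exact (liminf_le_liminf (v := fun _ => planePotential (x, 0)) (Eventually.of_forall fun n =>
    lintegral_planePotential_srwStopped_le hx n)).trans_eq (liminf_const _)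

theorem isRecurrentLaw_discreteCauchy : IsRecurrentLaw.{u} discreteCauchy :=
  isRecurrentLaw_of_allMixturesRecurrent (allMixturesRecurrent_of_planePotential
    (fun _ => inv_four_le_discreteCauchy_one) (fun _ => inv_four_le_discreteCauchy_neg_one)
    fun _ _ => lintegral_planePotential_discreteCauchy_le)

theorem allMixturesRecurrent_lazySignStep_discreteCauchy :
    AllMixturesRecurrent.{u} ![lazySignStep, discreteCauchy] := by
  have : ∀ j, IsProbabilityMeasure (![lazySignStep, discreteCauchy] j) :=
    Fin.forall_fin_two.2 ⟨lazySignStep_isProbabilityMeasure, discreteCauchy_isProbabilityMeasure⟩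
  exact allMixturesRecurrent_of_planePotential
    (Fin.forall_fin_two.2 ⟨inv_four_le_lazySignStep_one, inv_four_le_discreteCauchy_one⟩)
    (Fin.forall_fin_two.2 ⟨inv_four_le_lazySignStep_neg_one, inv_four_le_discreteCauchy_neg_one⟩)
    (Fin.forall_fin_two.2 ⟨fun _ => lintegral_planePotential_lazySignStep_le,
      fun _ => lintegral_planePotential_discreteCauchy_le⟩)

theorem allMixturesRecurrent_signStep_discreteCauchy :
    AllMixturesRecurrent.{u} ![signStep, discreteCauchy] := by
  have : ∀ j, IsProbabilityMeasure (![signStep, discreteCauchy] j) :=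
    Fin.forall_fin_two.2 ⟨signStep_isProbabilityMeasure, discreteCauchy_isProbabilityMeasure⟩
  exact allMixturesRecurrent_of_planePotential
    (Fin.forall_fin_two.2 ⟨inv_four_le_signStep_one, inv_four_le_discreteCauchy_one⟩)
    (Fin.forall_fin_two.2 ⟨inv_four_le_signStep_neg_one, inv_four_le_discreteCauchy_neg_one⟩)
    (Fin.forall_fin_two.2 ⟨fun _ => lintegral_planePotential_signStep_le,
      fun _ => lintegral_planePotential_discreteCauchy_le⟩)

/-! ### Benjamini's walk -/

theorem measurableSet_isFresh {Ω : Type u} (S : ℕ → Ω → ℤ) (n : ℕ) :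
    MeasurableSet[sigmaUpTo S n] {ω | IsFresh S n ω} := by
  have hm : ∀ l ≤ n, Measurable[sigmaUpTo S n] (S l) := fun l hl =>
    Measurable.of_comap_le (comap_le_sigmaUpTo S hl)
  simp only [IsFresh, Set.ofPred_forall]
  refine MeasurableSet.iInter fun l => MeasurableSet.iInter fun hl => ?_
  exact (measurableSet_eq_fun (hm l hl.le) (hm n le_rfl)).compl

open Classical in
/-- The index that governs the next step of Benjamini's walk: `1` at a fresh site, `0` elsewhere,
with the shift in time required by `IsStepMixture`. -/
def freshIndex {Ω : Type u} (S : ℕ → Ω → ℤ) (n : ℕ) (ω : Ω) : Fin 2 :=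
  if IsFresh S (n - 1) ω then 1 else 0

theorem measurable_freshIndex {Ω : Type u} (S : ℕ → Ω → ℤ) (n : ℕ) :
    Measurable[sigmaUpTo S (n - 1)] (freshIndex S n) :=
  Measurable.ite (measurableSet_isFresh S (n - 1)) measurable_const measurable_const

theorem IsBenjaminiWalk.isStepMixture {Ω : Type u} [MeasurableSpace Ω] {μ : Measure Ω}
    {S : ℕ → Ω → ℤ} (h : IsBenjaminiWalk μ S) :
    IsStepMixture μ ![signStep, discreteCauchy] S (freshIndex S) := by
  refine ⟨h.measurable_pos, fun n => (measurable_freshIndex S n).mono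
    (sigmaUpTo_le fun l _ => h.measurable_pos l) le_rfl, fun n A => ?_⟩
  have hσ : stepPast S (freshIndex S) n = sigmaUpTo S n := by
    refine le_antisymm (stepPast_le (fun l hl => Measurable.of_comap_le (comap_le_sigmaUpTo S hl))
      fun l hl => (measurable_freshIndex S l).mono (sigmaUpTo_mono S (by omega)) le_rfl)
      (le_sup_left.trans le_sup_left)
  change μ⟦_ | stepPast S (freshIndex S) n⟧ =ᵐ[μ] _
  rw [hσ]
  filter_upwards [h.condLaw n A] with ω hω
  rw [hω]
  by_cases hf : IsFresh S n ω <;> simp [freshIndex, hf]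

/-! ### Events of the past -/

section Past

variable {Ω : Type u} {ι : Type v} [MeasurableSpace ι] {S : ℕ → Ω → ℤ} {i : ℕ → Ω → ι}

theorem mem_iff_of_measurableSet_stepPast {n : ℕ} {B : Set Ω}
    (hB : MeasurableSet[stepPast S i n] B) {ω ω' : Ω} (hS : ∀ l ≤ n, S l ω = S l ω')
    (hi : ∀ l ≤ n + 1, i l ω = i l ω') : ω ∈ B ↔ ω' ∈ B := by
  -- the events that do not separate `ω` from `ω'` form a `σ`-field
  let m : MeasurableSpace Ω :=
    { MeasurableSet' := fun B => ω ∈ B ↔ ω' ∈ B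
      measurableSet_empty := by simp
      measurableSet_compl := fun B hB => not_congr hB
      measurableSet_iUnion := fun f hf => by
        simp only [Set.mem_iUnion]
        exact exists_congr hf }
  have hle : stepPast S i n ≤ m := by
    refine stepPast_le (fun l hl A _ => ?_) (fun l hl A _ => ?_)
    · change S l ω ∈ A ↔ S l ω' ∈ A
      rw [hS l hl]
    · change i l ω ∈ A ↔ i l ω' ∈ A
      rw [hi l hl]
  exact hle B hB

theorem measurableSet_stepPast_of_forall [Countable ι] [DiscreteMeasurableSpace ι] {n : ℕ}
    {B : Set Ω} (h : ∀ ω ω', (∀ l ≤ n, S l ω = S l ω') → (∀ l ≤ n + 1, i l ω = i l ω') →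
      ω ∈ B → ω' ∈ B) : MeasurableSet[stepPast S i n] B := by
  let W : Ω → (Fin (n + 1) → ℤ) × (Fin (n + 2) → ι) := fun ω => (fun l => S l ω, fun l => i l ω)
  have hW : Measurable[stepPast S i n] W := by
    refine Measurable.prodMk (m := stepPast S i n) ?_ ?_
    · exact @measurable_pi_lambda _ _ _ (stepPast S i n) _ _ fun l =>
        measurable_stepPast_pos (by omega)
    · exact @measurable_pi_lambda _ _ _ (stepPast S i n) _ _ fun l =>
        measurable_stepPast_index (by omega)
  have : B = W ⁻¹' (W '' B) := by
    refine Set.Subset.antisymm (Set.subset_preimage_image _ _) ?_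
    rintro ω' ⟨ω, hω, hωω'⟩
    refine h ω ω' (fun l hl => ?_) (fun l hl => ?_) hω
    · exact congrFun (congrArg Prod.fst hωω') ⟨l, by omega⟩
    · exact congrFun (congrArg Prod.snd hωω') ⟨l, by omega⟩
  rw [this]
  exact hW MeasurableSet.of_discrete

end Past

/-! ### Transfer to a canonical probability space -/

/-- Whether all mixtures are recurrent does not depend on the universe of the probability spaces:
the joint law of a mixture lives on the space of sequences in `ℤ × ℕ`. -/
theorem AllMixturesRecurrent.lift {ι : Type v} [Countable ι] [MeasurableSpace ι]
    [DiscreteMeasurableSpace ι] {Q : ι → Measure ℤ} [∀ j, IsProbabilityMeasure (Q j)]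
    (h : AllMixturesRecurrent.{0} Q) : AllMixturesRecurrent.{u} Q := by
  intro Ω _ μ _ S i hmix
  obtain ⟨ω₀⟩ := nonempty_of_isProbabilityMeasure μ
  have : Nonempty ι := ⟨i 0 ω₀⟩
  obtain ⟨e, he⟩ := exists_injective_nat ι
  let Φ : Ω → ℕ → ℤ × ℕ := fun ω n => (S n ω, e (i n ω))
  let S₀ : ℕ → (ℕ → ℤ × ℕ) → ℤ := fun n x => (x n).1
  let i₀ : ℕ → (ℕ → ℤ × ℕ) → ι := fun n x => Function.invFun e (x n).2
  have hΦ : Measurable Φ := measurable_pi_lambda _ fun n =>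
    (hmix.measurable_pos n).prodMk (Measurable.of_discrete.comp (hmix.measurable_index n))
  have hS₀ : ∀ n, Measurable (S₀ n) := fun n => measurable_fst.comp (measurable_pi_apply n)
  have hi₀ : ∀ n, Measurable (i₀ n) := fun n =>
    (Measurable.of_discrete (f := Function.invFun e)).comp
      (measurable_snd.comp (measurable_pi_apply n))
  have hiΦ : ∀ n ω, i₀ n (Φ ω) = i n ω := fun n ω => Function.leftInverse_invFun he _
  have hprob : IsProbabilityMeasure (μ.map Φ) := Measure.isProbabilityMeasure_map hΦ.aemeasurable
  have hrec := h (ℕ → ℤ × ℕ) (μ.map Φ) S₀ i₀ (isStepMixture_of_measure_inter_step hS₀ hi₀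
    (fun n j B hB k => ?_) (fun _ _ => prob_le_one))
  · exact ae_of_ae_map hΦ.aemeasurable hrec
  · have hle : stepPast S₀ i₀ n ≤ MeasurableSpace.map Φ (stepPast S i n) := by
      refine stepPast_le (fun l hl A hA => ?_) (fun l hl A hA => ?_)
      · exact measurable_stepPast_pos (S := S) (i := i) hl hA
      · change MeasurableSet[stepPast S i n] {ω | i₀ l (Φ ω) ∈ A}
        simp only [hiΦ]
        exact measurable_stepPast_index (S := S) (i := i) hl hA
    have hB0 : MeasurableSet B := stepPast_le (fun l _ => hS₀ l) (fun l _ => hi₀ l) _ hB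
    have hj : MeasurableSet {x | i₀ (n + 1) x = j} := hi₀ (n + 1) (measurableSet_singleton j)
    have hk : MeasurableSet {x | S₀ (n + 1) x - S₀ n x = k} :=
      ((hS₀ (n + 1)).sub (hS₀ n)) (measurableSet_singleton k)
    rw [Measure.map_apply hΦ ((hB0.inter hj).inter hk), Measure.map_apply hΦ (hB0.inter hj)]
    have := hmix.measure_inter_step n j (hle _ hB) {k}
    simpa only [Set.preimage_inter, Set.preimage_ofPred_eq, hiΦ, Set.mem_singleton_iff] using this

/-! ### Inserting pauses into a mixture -/

section Pauses

variable {Ω : Type u} {ι : Type v} {U : Type*}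

open Classical in
/-- The number of steps of the original process that have been made by time `m`, when the step
governed by the index `j` is postponed as long as the coin `c m` falls into the set `H j`. -/
def pausedClock (H : ι → Set U) (i : ℕ → ι) (c : ℕ → U) : ℕ → ℕ
  | 0 => 0
  | m + 1 => if c m ∈ H (i (pausedClock H i c m + 1)) then pausedClock H i c m
      else pausedClock H i c m + 1

variable {H : ι → Set U}

theorem pausedClock_succ_of_mem {i : ℕ → ι} {c : ℕ → U} {m : ℕ}
    (h : c m ∈ H (i (pausedClock H i c m + 1))) :
    pausedClock H i c (m + 1) = pausedClock H i c m := by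
  rw [pausedClock, if_pos h]

theorem pausedClock_succ_of_notMem {i : ℕ → ι} {c : ℕ → U} {m : ℕ}
    (h : c m ∉ H (i (pausedClock H i c m + 1))) :
    pausedClock H i c (m + 1) = pausedClock H i c m + 1 := by
  rw [pausedClock, if_neg h]

theorem pausedClock_mono (H : ι → Set U) (i : ℕ → ι) (c : ℕ → U) :
    Monotone (pausedClock H i c) := by
  refine monotone_nat_of_le_succ fun m => ?_
  by_cases h : c m ∈ H (i (pausedClock H i c m + 1))
  · exact (pausedClock_succ_of_mem h).ge
  · exact (pausedClock_succ_of_notMem h).ge.trans' (Nat.le_succ _)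

theorem pausedClock_congr {i i' : ℕ → ι} {c c' : ℕ → U} {m : ℕ}
    (hi : ∀ l ≤ pausedClock H i c m + 1, i l = i' l) (hc : ∀ l < m, c l = c' l) :
    pausedClock H i' c' m = pausedClock H i c m := by
  induction m with
  | zero => rfl
  | succ m ih =>
    have hle := pausedClock_mono H i c (Nat.le_add_right m 1)
    have ih' := ih (fun l hl => hi l (by omega)) (fun l hl => hc l (by omega))
    have h1 : i' (pausedClock H i c m + 1) = i (pausedClock H i c m + 1) :=
      (hi _ (by omega)).symm
    rw [pausedClock, pausedClock, ih', h1, hc m (Nat.lt_succ_self m)]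

theorem tendsto_pausedClock {i : ℕ → ι} {c : ℕ → U}
    (h : ∀ n, ∃ᶠ m in atTop, c m ∉ H (i (n + 1))) :
    Tendsto (pausedClock H i c) atTop atTop := by
  refine tendsto_atTop_atTop_of_monotone (pausedClock_mono H i c) fun b => ?_
  induction b with
  | zero => exact ⟨0, Nat.zero_le _⟩
  | succ b ih =>
    obtain ⟨a, ha⟩ := ih
    obtain ⟨m, hm, hcm⟩ := frequently_atTop.1 (h b) a
    have h1 : b ≤ pausedClock H i c m := ha.trans (pausedClock_mono H i c hm)
    rcases h1.eq_or_lt with h1 | h1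
    · rw [h1] at hcm
      exact ⟨m + 1, by rw [pausedClock_succ_of_notMem hcm, ← h1]⟩
    · exact ⟨m, h1⟩

/-- The mixture `S` slowed down by the pauses. -/
def pausedPos (H : ι → Set U) (S : ℕ → Ω → ℤ) (i : ℕ → Ω → ι) (m : ℕ) (p : Ω × (ℕ → U)) : ℤ :=
  S (pausedClock H (fun n => i n p.1) p.2 m) p.1

/-- The index of the original step that is due at time `m - 1`. The value at `m = 0` plays no role;
with truncated subtraction it equals the one at `m = 1`. -/
def pausedIndex (H : ι → Set U) (i : ℕ → Ω → ι) (m : ℕ) (p : Ω × (ℕ → U)) : ι :=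
  i (pausedClock H (fun n => i n p.1) p.2 (m - 1) + 1) p.1

section Measurability

variable [MeasurableSpace Ω] [MeasurableSpace ι] [Countable ι] [DiscreteMeasurableSpace ι]
  [MeasurableSpace U] {S : ℕ → Ω → ℤ} {i : ℕ → Ω → ι}

theorem measurable_apply_nat {X E : Type*} [MeasurableSpace X] [MeasurableSpace E] {N : X → ℕ}
    (hN : Measurable N) {f : ℕ → X → E} (hf : ∀ n, Measurable (f n)) :
    Measurable fun x => f (N x) x :=
  (measurable_from_prod_countable_right (f := fun q : ℕ × X => f q.1 q.2) hf).comp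
    (hN.prodMk measurable_id)

theorem measurable_pausedClock (hH : ∀ j, MeasurableSet (H j)) (hi : ∀ n, Measurable (i n))
    (m : ℕ) : Measurable fun p : Ω × (ℕ → U) => pausedClock H (fun n => i n p.1) p.2 m := by
  induction m with
  | zero => exact measurable_const
  | succ m ih =>
    have hHm : MeasurableSet {q : ι × U | q.2 ∈ H q.1} := by
      have : {q : ι × U | q.2 ∈ H q.1} = ⋃ j, {j} ×ˢ H j := by
        ext ⟨j, x⟩; simp
      rw [this]
      exact MeasurableSet.iUnion fun j => (measurableSet_singleton j).prod (hH j)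
    have hidx : Measurable fun p : Ω × (ℕ → U) =>
        i (pausedClock H (fun n => i n p.1) p.2 m + 1) p.1 :=
      measurable_apply_nat ih fun n => (hi (n + 1)).comp measurable_fst
    exact Measurable.ite ((hidx.prodMk ((measurable_pi_apply m).comp measurable_snd)) hHm) ih
      (ih.add_const 1)

theorem measurable_pausedPos (hH : ∀ j, MeasurableSet (H j)) (hS : ∀ n, Measurable (S n))
    (hi : ∀ n, Measurable (i n)) (m : ℕ) : Measurable (pausedPos H S i m) :=
  measurable_apply_nat (measurable_pausedClock hH hi m) fun n => (hS n).comp measurable_fst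

theorem measurable_pausedIndex (hH : ∀ j, MeasurableSet (H j)) (hi : ∀ n, Measurable (i n))
    (m : ℕ) : Measurable (pausedIndex H i m) :=
  measurable_apply_nat (measurable_pausedClock hH hi (m - 1))
    fun n => (hi (n + 1)).comp measurable_fst

end Measurability

/-- An event of the past of the slowed-down mixture at time `m`, on which `n` original steps have
been made, depends on the past of the original mixture before its step number `n` and on the first
`m` coins only. -/
theorem mem_of_pausedClock_eq [MeasurableSpace ι] {S : ℕ → Ω → ℤ} {i : ℕ → Ω → ι} {m n : ℕ}
    {B : Set (Ω × (ℕ → U))}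
    (hB : MeasurableSet[stepPast (pausedPos H S i) (pausedIndex H i) m] B) {ω ω' : Ω}
    {c c' : ℕ → U} (hn : pausedClock H (fun l => i l ω) c m = n)
    (hS : ∀ l ≤ n, S l ω = S l ω') (hi : ∀ l ≤ n + 1, i l ω = i l ω') (hc : ∀ l < m, c l = c' l)
    (hmem : (ω, c) ∈ B) :
    (ω', c') ∈ B ∧ pausedClock H (fun l => i l ω') c' m = n := by
  have hr : ∀ r ≤ m, pausedClock H (fun l => i l ω) c r ≤ n := fun r hr =>
    hn ▸ pausedClock_mono H _ c hr
  have hclock : ∀ r ≤ m,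
      pausedClock H (fun l => i l ω') c' r = pausedClock H (fun l => i l ω) c r :=
    fun r hrm => pausedClock_congr (fun l hl => hi l (by have := hr r hrm; omega))
      (fun l hl => hc l (by omega))
  refine ⟨(mem_iff_of_measurableSet_stepPast hB (fun l hl => ?_) (fun l hl => ?_)).1 hmem,
    (hclock m le_rfl).trans hn⟩
  · simp only [pausedPos]
    rw [hclock l hl]
    exact hS _ (hr l hl)
  · simp only [pausedIndex]
    rw [hclock (l - 1) (by omega)]
    exact hi _ (by have := hr (l - 1) (by omega); omega)

section Law

variable [MeasurableSpace Ω] {μ : Measure Ω} [IsProbabilityMeasure μ] [MeasurableSpace ι]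
  [Countable ι] [DiscreteMeasurableSpace ι] [MeasurableSpace U] {ρ : Measure U}
  [IsProbabilityMeasure ρ] {P Q : ι → Measure ℤ} [∀ j, IsFiniteMeasure (P j)]
  {S : ℕ → Ω → ℤ} {i : ℕ → Ω → ι}

/-- A function of the first `m` coins is independent of the coin number `m`. -/
theorem lintegral_mul_indicator_coin (m : ℕ) {f : (ℕ → U) → ℝ≥0∞} (hf : Measurable f)
    (hfm : ∀ c c' : ℕ → U, (∀ l < m, c l = c' l) → f c = f c') {E : Set U}
    (hE : MeasurableSet E) :
    ∫⁻ c, f c * ((fun c : ℕ → U => c m) ⁻¹' E).indicator (fun _ => 1) c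
        ∂(Measure.infinitePi fun _ : ℕ => ρ)
      = (∫⁻ c, f c ∂(Measure.infinitePi fun _ : ℕ => ρ)) * ρ E := by
  classical
  have hX : ∀ n, Measurable fun c : ℕ → U => c n := fun n => measurable_pi_apply n
  have hind : iIndepFun (fun n (c : ℕ → U) => c n) (Measure.infinitePi fun _ : ℕ => ρ) :=
    iIndepFun_infinitePi (P := fun _ : ℕ => ρ) (X := fun _ x => x) fun _ => measurable_id
  have hmap : (Measure.infinitePi fun _ : ℕ => ρ).map (fun c : ℕ → U => c m) = ρ :=
    Measure.infinitePi_map_eval (fun _ : ℕ => ρ) m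
  obtain ⟨u₀⟩ := nonempty_of_isProbabilityMeasure ρ
  have hfM : Measurable[sigmaBefore (fun n (c : ℕ → U) => c n) m] f := by
    have hr : Measurable[sigmaBefore (fun n (c : ℕ → U) => c n) m]
        fun (c : ℕ → U) (l : ℕ) => if l < m then c l else u₀ := by
      refine @measurable_pi_lambda _ _ _
        (sigmaBefore (fun n (c : ℕ → U) => c n) m) _ _ fun l => ?_
      by_cases hl : l < m
      · simp only [hl, if_true]
        exact measurable_sigmaBefore (fun n (c : ℕ → U) => c n) hl
      · simp only [hl, if_false]
        exact measurable_const
    have : f = f ∘ fun (c : ℕ → U) (l : ℕ) => if l < m then c l else u₀ :=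
      funext fun c => hfm _ _ fun l hl => by simp [hl]
    rw [this]
    exact hf.comp hr
  rw [lintegral_mul_indicator_eq_lintegral_mul_lintegral_indicator
    (sigmaBefore_le hX m) 1 (hX m hE) ?_ hfM,
    lintegral_indicator_const (hX m hE), one_mul, ← Measure.map_apply (hX m) hE, hmap]
  refine (IndepSets_iff _ _ _).2 fun A T hA hT => ?_
  rw [Set.mem_singleton_iff.1 hT, measure_inter_preimage_of_iIndepFun hX hind m hA hE,
    Measure.map_apply (hX m) hE]

/-- On an event of the past of the slowed-down mixture on which `n` original steps have been made
and the index `j` is due, the next coin and the next original increment are independent of the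
past and of each other. -/
theorem measure_inter_coin_inter_step (h : IsStepMixture μ P S i) (hH : ∀ j, MeasurableSet (H j))
    (m n : ℕ) (j : ι) {B : Set (Ω × (ℕ → U))}
    (hB : MeasurableSet[stepPast (pausedPos H S i) (pausedIndex H i) m] B) {E : Set U}
    (hE : MeasurableSet E) (A : Set ℤ) :
    (μ.prod (Measure.infinitePi fun _ : ℕ => ρ))
        (B ∩ {p | pausedIndex H i (m + 1) p = j} ∩
          {p | pausedClock H (fun l => i l p.1) p.2 m = n} ∩
          {p | p.2 m ∈ E ∧ S (n + 1) p.1 - S n p.1 ∈ A})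
      = (μ.prod (Measure.infinitePi fun _ : ℕ => ρ))
        (B ∩ {p | pausedIndex H i (m + 1) p = j} ∩
          {p | pausedClock H (fun l => i l p.1) p.2 m = n}) * (ρ E * P j A) := by
  have hS := h.measurable_pos
  have hi := h.measurable_index
  set C := B ∩ {p | pausedIndex H i (m + 1) p = j} ∩
          {p | pausedClock H (fun l => i l p.1) p.2 m = n} with hC
  have hBj : MeasurableSet[stepPast (pausedPos H S i) (pausedIndex H i) m]
      (B ∩ {p | pausedIndex H i (m + 1) p = j}) :=
    hB.inter (measurable_stepPast_index le_rfl (measurableSet_singleton j))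
  have hpast : stepPast (pausedPos H S i) (pausedIndex (U := U) H i) m ≤ Prod.instMeasurableSpace :=
    _root_.stepPast_le (fun l _ => measurable_pausedPos hH hS hi l)
      (fun l _ => measurable_pausedIndex hH hi l)
  have hCm : MeasurableSet C :=
    (hpast _ hBj).inter (measurable_pausedClock hH hi m (measurableSet_singleton n))
  have hΔ : MeasurableSet {ω | S (n + 1) ω - S n ω ∈ A} :=
    ((hS (n + 1)).sub (hS n)) MeasurableSet.of_discrete
  have hD : MeasurableSet {p : Ω × (ℕ → U) | p.2 m ∈ E ∧ S (n + 1) p.1 - S n p.1 ∈ A} :=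
    (((measurable_pi_apply m).comp measurable_snd) hE).inter (measurable_fst hΔ)
  have hsat : ∀ ω ω' c c', (∀ l ≤ n, S l ω = S l ω') → (∀ l ≤ n + 1, i l ω = i l ω') →
      (∀ l < m, c l = c' l) → (ω, c) ∈ C → (ω', c') ∈ C := fun ω ω' c c' h1 h2 h3 h4 =>
    mem_of_pausedClock_eq hBj h4.2 h1 h2 h3 h4.1
  have hsec : ∀ c, MeasurableSet[stepPast S i n] {ω | (ω, c) ∈ C} := fun c =>
    measurableSet_stepPast_of_forall fun ω ω' h1 h2 => hsat ω ω' c c h1 h2 fun _ _ => rfl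
  have hidx : ∀ c, {ω | (ω, c) ∈ C} ∩ {ω | i (n + 1) ω = j} = {ω | (ω, c) ∈ C} := by
    refine fun c => Set.inter_eq_left.2 fun ω hω => ?_
    have h1 : pausedIndex H i (m + 1) (ω, c) = j := hω.1.2
    have h2 : pausedClock H (fun l => i l ω) c m = n := hω.2
    simpa [pausedIndex, h2] using h1
  have hf : Measurable fun c : ℕ → U => μ {ω | (ω, c) ∈ C} := measurable_measure_prodMk_right hCm
  rw [Measure.prod_apply_symm (hCm.inter hD), Measure.prod_apply_symm hCm, ← mul_assoc]
  have hval : ∀ c : ℕ → U, μ ((fun ω => (ω, c)) ⁻¹'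
        (C ∩ {p | p.2 m ∈ E ∧ S (n + 1) p.1 - S n p.1 ∈ A}))
      = (μ {ω | (ω, c) ∈ C} * ((fun c : ℕ → U => c m) ⁻¹' E).indicator (fun _ => 1) c) * P j A := by
    intro c
    by_cases hc : c m ∈ E
    · have := h.measure_inter_step n j (hsec c) A
      rw [hidx] at this
      rw [Set.indicator_of_mem (show c ∈ (fun c : ℕ → U => c m) ⁻¹' E from hc), mul_one, ← this]
      congr 1
      ext ω
      simp [hc]
    · rw [Set.indicator_of_notMem (show c ∉ (fun c : ℕ → U => c m) ⁻¹' E from hc), mul_zero,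
        zero_mul]
      have : (fun ω => (ω, c)) ⁻¹' (C ∩ {p | p.2 m ∈ E ∧ S (n + 1) p.1 - S n p.1 ∈ A}) = ∅ := by
        ext ω
        simp [hc]
      rw [this, measure_empty]
  simp_rw [hval]
  rw [lintegral_mul_const' _ _ (measure_ne_top _ _),
    lintegral_mul_indicator_coin m hf (fun c c' hcc' => ?_) hE]
  · rfl
  · congr 1
    ext ω
    exact ⟨hsat ω ω c c' (fun _ _ => rfl) (fun _ _ => rfl) hcc',
      hsat ω ω c' c (fun _ _ => rfl) (fun _ _ => rfl) fun l hl => (hcc' l hl).symm⟩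

/-- If the law `Q j` makes a pause with probability `ρ (H j)` and otherwise a step of law `P j`,
then slowing down a mixture of the laws `P j` gives a mixture of the laws `Q j`. -/
theorem IsStepMixture.paused [∀ j, IsProbabilityMeasure (Q j)] (h : IsStepMixture μ P S i)
    (hH : ∀ j, MeasurableSet (H j))
    (hQ : ∀ j k, Q j {k} = ρ (H j) * Measure.dirac 0 {k} + ρ (H j)ᶜ * P j {k}) :
    IsStepMixture (μ.prod (Measure.infinitePi fun _ : ℕ => ρ)) Q (pausedPos H S i)
      (pausedIndex H i) := by
  have hS := h.measurable_pos
  have hi := h.measurable_index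
  refine isStepMixture_of_measure_inter_step (fun m => measurable_pausedPos hH hS hi m)
    (fun m => measurable_pausedIndex hH hi m) (fun m j B hB k => ?_) (fun _ _ => prob_le_one)
  set ν := μ.prod (Measure.infinitePi fun _ : ℕ => ρ)
  set C := B ∩ {p | pausedIndex H i (m + 1) p = j} with hC
  have hpast : stepPast (pausedPos H S i) (pausedIndex (U := U) H i) m ≤ Prod.instMeasurableSpace :=
    _root_.stepPast_le (fun l _ => measurable_pausedPos hH hS hi l)
      (fun l _ => measurable_pausedIndex hH hi l)
  have hCm : MeasurableSet C :=
    (hpast _ hB).inter (measurable_pausedIndex hH hi (m + 1) (measurableSet_singleton j))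
  have hclock : ∀ n, MeasurableSet
      {p : Ω × (ℕ → U) | pausedClock H (fun l => i l p.1) p.2 m = n} := fun n =>
    measurable_pausedClock hH hi m (measurableSet_singleton n)
  have hstep : MeasurableSet {p | pausedPos (U := U) H S i (m + 1) p - pausedPos H S i m p = k} :=
    ((measurable_pausedPos hH hS hi (m + 1)).sub (measurable_pausedPos hH hS hi m))
      (measurableSet_singleton k)
  have key : ∀ n, ν (C ∩ {p | pausedClock H (fun l => i l p.1) p.2 m = n} ∩
        {p | pausedPos H S i (m + 1) p - pausedPos H S i m p = k})
      = ν (C ∩ {p | pausedClock H (fun l => i l p.1) p.2 m = n}) * Q j {k} := by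
    intro n
    have hcoin : MeasurableSet {p : Ω × (ℕ → U) | p.2 m ∈ H j} :=
      ((measurable_pi_apply m).comp measurable_snd) (hH j)
    have h1 := measure_inter_coin_inter_step (ρ := ρ) h hH m n j hB (hH j) Set.univ
    have h2 := measure_inter_coin_inter_step (ρ := ρ) h hH m n j hB (hH j).compl {k}
    have h0 := measure_inter_coin_inter_step (ρ := ρ) h hH m n j hB MeasurableSet.univ Set.univ
    set D := C ∩ {p | pausedClock H (fun l => i l p.1) p.2 m = n} with hD
    have hDj : ∀ p ∈ D, i (pausedClock H (fun l => i l p.1) p.2 m + 1) p.1 = j :=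
      fun p hp => hp.1.2
    have hDn : ∀ p ∈ D, pausedClock H (fun l => i l p.1) p.2 m = n := fun p hp => hp.2
    simp only [Set.mem_univ, and_self, and_true, Set.ofPred_true, Set.inter_univ, measure_univ,
      one_mul] at h0 h1
    -- `P j` has mass `1` unless the index `j` is almost surely never used
    have h1' : ν (D ∩ {p | p.2 m ∈ H j}) = ν D * ρ (H j) := by
      rw [h1, mul_comm (ρ (H j)), ← mul_assoc, ← h0]
    rw [← measure_inter_add_sdiff _ hcoin, hQ, mul_add, ← h2]
    congr 1
    · by_cases hk : k = 0
      · subst hk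
        rw [Measure.dirac_apply_of_mem (Set.mem_singleton _), mul_one, ← h1']
        congr 1
        ext p
        simp only [Set.mem_inter_iff, Set.mem_ofPred_eq]
        refine ⟨fun hp => ⟨hp.1.1, hp.2⟩, fun hp => ⟨⟨hp.1, ?_⟩, hp.2⟩⟩
        have : p.2 m ∈ H (i (pausedClock H (fun l => i l p.1) p.2 m + 1) p.1) := by
          rw [hDj p hp.1]; exact hp.2
        simp only [pausedPos]
        rw [pausedClock_succ_of_mem this, sub_self]
      · have he : D ∩ {p | pausedPos H S i (m + 1) p - pausedPos H S i m p = k}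
            ∩ {p | p.2 m ∈ H j} = ∅ := by
          refine Set.eq_empty_of_forall_notMem fun p hp => hk ?_
          have : p.2 m ∈ H (i (pausedClock H (fun l => i l p.1) p.2 m + 1) p.1) := by
            rw [hDj p hp.1.1]; exact hp.2
          have hs : pausedPos H S i (m + 1) p - pausedPos H S i m p = k := hp.1.2
          simp only [pausedPos] at hs
          rw [pausedClock_succ_of_mem this, sub_self] at hs
          exact hs.symm
        rw [he, measure_empty, Measure.dirac_apply' _ (measurableSet_singleton k),
          Set.indicator_of_notMem (by simpa using Ne.symm hk), mul_zero, mul_zero]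
    · congr 1
      ext p
      simp only [Set.mem_inter_iff, Set.mem_ofPred_eq, Set.mem_sdiff, Set.mem_compl_iff,
        Set.mem_singleton_iff, and_assoc]
      refine and_congr_right fun hp => ?_
      rw [and_comm]
      refine and_congr_right fun hcp => ?_
      have : p.2 m ∉ H (i (pausedClock H (fun l => i l p.1) p.2 m + 1) p.1) := by
        rw [hDj p hp]; exact hcp
      simp only [pausedPos]
      rw [pausedClock_succ_of_notMem this, hDn p hp]
  have hU : C = ⋃ n, C ∩ {p | pausedClock H (fun l => i l p.1) p.2 m = n} := by
    ext p; simp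
  have hdis : Pairwise (Function.onFun Disjoint fun n =>
      C ∩ {p | pausedClock H (fun l => i l p.1) p.2 m = n}) := by
    intro n n' hnn'
    exact Set.disjoint_left.2 fun p h1 h2 => hnn' (h1.2.symm.trans h2.2)
  conv_lhs => rw [hU, Set.iUnion_inter]
  conv_rhs => rw [hU]
  rw [measure_iUnion hdis fun n => hCm.inter (hclock n), measure_iUnion (hdis.mono fun n n' hnn' =>
      hnn'.mono Set.inter_subset_left Set.inter_subset_left)
      fun n => (hCm.inter (hclock n)).inter hstep, ← ENNReal.tsum_mul_right]
  exact tsum_congr key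

theorem ae_frequently_notMem {E : Set U} (hE : MeasurableSet E) (hρ : ρ E ≠ 1) :
    ∀ᵐ c ∂(Measure.infinitePi fun _ : ℕ => ρ), ∃ᶠ m in atTop, c m ∉ E := by
  have hX : ∀ n, Measurable fun c : ℕ → U => c n := fun n => measurable_pi_apply n
  have hind : iIndepFun (fun n (c : ℕ → U) => c n) (Measure.infinitePi fun _ : ℕ => ρ) :=
    iIndepFun_infinitePi (P := fun _ : ℕ => ρ) (X := fun _ x => x) fun _ => measurable_id
  have hms : ∀ n : ℕ, MeasurableSet ((fun c : ℕ → U => c n) ⁻¹' Eᶜ) := fun n => hX n hE.compl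
  have hset : iIndepSet (fun n => (fun c : ℕ → U => c n) ⁻¹' Eᶜ)
      (Measure.infinitePi fun _ : ℕ => ρ) := (iIndepSet_iff_meas_biInter hms).2 fun s =>
    hind.measure_inter_preimage_eq_mul s fun _ _ => hE.compl
  have hval : ∀ n : ℕ, (Measure.infinitePi fun _ : ℕ => ρ) ((fun c : ℕ → U => c n) ⁻¹' Eᶜ)
      = ρ Eᶜ := fun n => by
    rw [← Measure.map_apply (hX n) hE.compl, Measure.infinitePi_map_eval (fun _ : ℕ => ρ) n]
  have hpos : ρ Eᶜ ≠ 0 := fun h => hρ ((prob_compl_eq_zero_iff hE).1 h)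
  have hlim := measure_limsup_eq_one hms hset (by
    simp_rw [hval]
    exact ENNReal.tsum_const_eq_top_of_ne_zero hpos)
  have hmem : ∀ᵐ c ∂(Measure.infinitePi fun _ : ℕ => ρ),
      c ∈ limsup (fun n => (fun c : ℕ → U => c n) ⁻¹' Eᶜ) atTop :=
    (mem_ae_iff_prob_eq_one (MeasurableSet.measurableSet_limsup hms)).2 hlim
  filter_upwards [hmem] with c hc
  exact mem_limsup_iff_frequently_mem.1 hc

/-- A mixture is recurrent as soon as the process slowed down by pauses is. -/
theorem IsStepMixture.isRecurrentProcess_of_paused (h : IsStepMixture μ P S i)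
    (hH : ∀ j, MeasurableSet (H j)) (hP : ∀ j, ρ (H j) = 1 → P j = 0)
    (hrec : IsRecurrentProcess (μ.prod (Measure.infinitePi fun _ : ℕ => ρ)) (pausedPos H S i)) :
    IsRecurrentProcess μ S := by
  have hidx : ∀ᵐ ω ∂μ, ∀ n, ρ (H (i (n + 1) ω)) ≠ 1 := by
    have hj : ∀ᵐ ω ∂μ, ∀ n j, ρ (H j) = 1 → i (n + 1) ω ≠ j := by
      refine ae_all_iff.2 fun n => ae_all_iff.2 fun j => ?_
      by_cases hj : ρ (H j) = 1
      · have := h.measure_inter_step n j MeasurableSet.univ Set.univ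
        simp only [hP j hj, Set.mem_univ, Set.ofPred_true, Set.inter_univ, Set.univ_inter,
          Measure.coe_zero, Pi.zero_apply, mul_zero] at this
        filter_upwards [measure_eq_zero_iff_ae_notMem.1 this] with ω hω _
        exact hω
      · exact ae_of_all _ fun ω h' => absurd h' hj
    filter_upwards [hj] with ω hω n hn
    exact hω n _ hn rfl
  have hcoin : ∀ᵐ c ∂(Measure.infinitePi fun _ : ℕ => ρ), ∀ j, ρ (H j) ≠ 1 →
      ∃ᶠ m in atTop, c m ∉ H j := by
    refine ae_all_iff.2 fun j => ?_
    by_cases hj : ρ (H j) = 1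
    · exact ae_of_all _ fun c h' => absurd hj h'
    · filter_upwards [ae_frequently_notMem (hH j) hj] with c hc _
      exact hc
  filter_upwards [Measure.ae_ae_of_ae_prod hrec, hidx] with ω hω hωi x
  obtain ⟨c, hc, hcc⟩ := (hω.and hcoin).exists
  have hlim := tendsto_pausedClock (H := H) (i := fun n => i n ω) (c := c)
    fun n => hcc _ (hωi n)
  exact hlim.frequently (hc x)

end Law

end Pauses

/-! ### Removal of laziness -/

/-- The pause has the probability `Q j {0}` when `j ∈ I` and never happens otherwise. -/
theorem allMixturesRecurrent_of_conditioned {ι : Type v} [Countable ι] [MeasurableSpace ι]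
    [DiscreteMeasurableSpace ι] {Q P : ι → Measure ℤ} {I : Set ι}
    (hQ : ∀ j, IsProbabilityMeasure (Q j)) (hPQ : ∀ j, j ∉ I → P j = Q j)
    (hPI : ∀ j, j ∈ I → P j = (Q j)[|{0}ᶜ]) (h : AllMixturesRecurrent.{0} Q) :
    AllMixturesRecurrent.{u} P := by
  classical
  intro Ω _ μ _ S i hmix
  have hfin : ∀ j, IsFiniteMeasure (P j) := fun j => by
    by_cases hj : j ∈ I
    · rw [hPI j hj]; infer_instance
    · rw [hPQ j hj]; infer_instance
  let q : ι → unitInterval := fun j => ⟨(Q j).real {0}, measureReal_nonneg, measureReal_le_one⟩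
  let H : ι → Set unitInterval := fun j => if j ∈ I then Set.Iic (q j) else ∅
  have hH : ∀ j, MeasurableSet (H j) := fun j => by
    by_cases hj : j ∈ I <;> simp [H, hj, measurableSet_Iic]
  have hHI : ∀ j ∈ I, volume (H j) = Q j {0} := fun j hj => by
    simp only [H, if_pos hj, unitInterval.volume_Iic, q]
    exact ofReal_measureReal
  have hHI' : ∀ j ∈ I, volume (H j)ᶜ = Q j {0}ᶜ := fun j hj => by
    rw [prob_compl_eq_one_sub (hH j), hHI j hj, prob_compl_eq_one_sub (measurableSet_singleton 0)]
  have hmass : ∀ j, volume (H j) = 1 → P j = 0 := by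
    intro j hj
    by_cases hjI : j ∈ I
    · rw [hPI j hjI, cond_eq_zero_of_meas_eq_zero]
      rw [prob_compl_eq_zero_iff (measurableSet_singleton 0), ← hHI j hjI, hj]
    · simp [H, hjI] at hj
  refine hmix.isRecurrentProcess_of_paused hH hmass (h.lift _ _ _ _ (hmix.paused hH fun j k => ?_))
  by_cases hj : j ∈ I
  · rw [hHI j hj, hHI' j hj, hPI j hj, cond_apply (measurableSet_singleton 0).compl, ← mul_assoc]
    have hk : (if k = 0 then Q j {0} else 0) + Q j ({0}ᶜ ∩ {k}) = Q j {k} := by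
      by_cases hk : k = 0
      · simp [hk]
      · have : ({0}ᶜ ∩ {k} : Set ℤ) = {k} := by
          rw [Set.inter_eq_right]; simpa using Ne.symm hk
        simp [hk, this]
    rw [← hk]
    congr 1
    · by_cases hk : k = 0
      · simp [hk]
      · simp [hk, Ne.symm hk]
    · by_cases h0 : Q j {0}ᶜ = 0
      · rw [h0, zero_mul, zero_mul, measure_mono_null Set.inter_subset_left h0]
      · rw [ENNReal.mul_inv_cancel h0 (measure_ne_top _ _), one_mul]
  · simp [H, hj, hPQ j hj]

end

theorem mainTheorem2 :
    -- simple random walk on `ℤ²` returns to the horizontal axis almost surely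
    (∀ᵐ ξ ∂srwLaw, ∃ n : ℕ, 0 < n ∧ (srwPos ξ n).2 = 0) ∧
    -- the discrete Cauchy law is recurrent
    IsRecurrentLaw.{u} discreteCauchy ∧
    -- any mixture of lazy `±1` steps and discrete Cauchy steps is recurrent
    AllMixturesRecurrent.{u} ![lazySignStep, discreteCauchy] ∧
    -- removal of the laziness, for an arbitrary countable family of laws
    (∀ (ι : Type v) [Countable ι] [MeasurableSpace ι] [DiscreteMeasurableSpace ι]
        (Q P : ι → Measure ℤ) (I : Set ι),
        (∀ j, IsProbabilityMeasure (Q j)) →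
        (∀ j, j ∉ I → P j = Q j) →
        (∀ j, j ∈ I → P j = (Q j)[|{0}ᶜ]) →
        AllMixturesRecurrent.{0} Q → AllMixturesRecurrent.{u} P) ∧
    -- any mixture of `±1` steps and discrete Cauchy steps is recurrent
    AllMixturesRecurrent.{u} ![signStep, discreteCauchy] ∧
    -- Benjamini's walk is recurrent
    (∀ (Ω : Type u) [MeasurableSpace Ω] (μ : Measure Ω) [IsProbabilityMeasure μ]
        (S : ℕ → Ω → ℤ), IsBenjaminiWalk μ S → IsRecurrentProcess μ S) :=
  ⟨ae_exists_srwPos_snd_eq_zero, isRecurrentLaw_discreteCauchy,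
    allMixturesRecurrent_lazySignStep_discreteCauchy,
    fun _ _ _ _ _ _ _ hQ hPQ hPI h => allMixturesRecurrent_of_conditioned hQ hPQ hPI h,
    allMixturesRecurrent_signStep_discreteCauchy,
    fun Ω _ μ _ S h => allMixturesRecurrent_signStep_discreteCauchy Ω μ S _ h.isStepMixture⟩
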